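/- Let $K$ be a field, let $C$ be a finite-dimensional $K$-coalgebra, let $D$ be any $K$-coalgebra, and let $\lambda\colon C\to D$ be a morphism of $K$-coalgebras. Write $\mathcal M^C$ and $\mathcal M^D$ for the categories of right $C$- and right $D$-comodules, and let $U\colon\mathcal M^C\to\mathcal M^D$ be the corestriction functor, which sends a comodule $M$ with coaction $m\mapsto m_0\otimes m_1$ to the space $M$ with coaction $m\mapsto m_0\otimes\lambda(m_1)$ and is the identity on morphisms. Call $\lambda$ a Frobenius extension of coalgebras if $U$ is a Frobenius functor, i.e. $U$ has a left adjoint and a right adjoint and these are naturally isomorphic. Let $C^*$ and $D^*$ be the dual algebras with the convolution product $(g*h)(c)=g(c_1)h(c_2)$ and unit the counit, and let $\lambda^*\colon D^*\to C^*$, $g\mapsto g\circ\lambda$, be the dual algebra map. Call a ring homomorphism $\varphi\colon A\to B$ a Frobenius extension if $B$ is a finitely generated projective left $A$-module and $B\cong\operatorname{Hom}_A({}_AB,{}_AA)$ as $(B,A)$-bimodules, where $(b\cdot g)(x)=g(xb)$ and $(g\cdot a)(x)=g(x)a$. Then the following assertions are equivalent: (i) $\lambda\colon C\to D$ is a Frobenius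 extension of coalgebras; (ii) $\lambda^*\colon D^*\to C^*$ is a Frobenius extension of algebras (rings). Moreover, in this case $C$, regarded as a $D$-comodule through $\lambda$, is finitely cogenerated (that is, it embeds as a $D$-comodule into $D^n$ for some $n\in\mathbb N$) and injective, both as a left and as a right $D$-comodule, and $C^*$, regarded as a $D^*$-module through $\lambda^*$, is finitely generated and projective, both as a left and as a right $D^*$-module. -/

import Mathlib

open CategoryTheory TensorProduct

universe u

/-- A functor is Frobenius if it has a left adjoint and a right adjoint which are naturally
isomorphic. -/
def IsFrobeniusFunctor {A B : Type*} [Category A] [Category B] (U : A ⥤ B) : Prop :=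
  ∃ L R : B ⥤ A, Nonempty (L ⊣ U) ∧ Nonempty (U ⊣ R) ∧ Nonempty (L ≅ R)

section RightComodules

/-- Right comodules over the `K`-coalgebra `C`. -/
structure RightComodule (K C : Type u) [Field K] [AddCommGroup C] [Module K C]
    [Coalgebra K C] where
  carrier : Type u
  [addCommGroup : AddCommGroup carrier]
  [module : Module K carrier]
  /-- the coaction `m ↦ m₀ ⊗ m₁` -/
  coact : carrier →ₗ[K] carrier ⊗[K] C
  coassoc : (TensorProduct.assoc K carrier C C).toLinearMap ∘ₗ coact.rTensor C ∘ₗ coact =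
    (Coalgebra.comul (R := K) (A := C)).lTensor carrier ∘ₗ coact
  counit_coact : (TensorProduct.rid K carrier).toLinearMap ∘ₗ
    (Coalgebra.counit (R := K) (A := C)).lTensor carrier ∘ₗ coact = LinearMap.id

attribute [instance] RightComodule.addCommGroup RightComodule.module

namespace RightComodule

variable {K C D : Type u} [Field K] [AddCommGroup C] [Module K C] [Coalgebra K C]
  [AddCommGroup D] [Module K D] [Coalgebra K D]

/-- Morphisms of right comodules: linear maps `f` with `f(m)₀ ⊗ f(m)₁ = f(m₀) ⊗ m₁`. -/
@[ext]
structure Hom (M N : RightComodule K C) where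
  toLinearMap : M.carrier →ₗ[K] N.carrier
  comm : N.coact ∘ₗ toLinearMap = toLinearMap.rTensor C ∘ₗ M.coact

/-- The category of right `C`-comodules. -/
instance : Category (RightComodule K C) where
  Hom := Hom
  id M := ⟨LinearMap.id, by simp⟩
  comp f g := ⟨g.toLinearMap ∘ₗ f.toLinearMap, by
    rw [← LinearMap.comp_assoc, g.comm, LinearMap.comp_assoc, f.comm, LinearMap.rTensor_comp,
      LinearMap.comp_assoc]⟩

variable (K C) in
/-- `C` as a right comodule over itself, through its comultiplication. -/
abbrev regular : RightComodule K C where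
  carrier := C
  coact := Coalgebra.comul
  coassoc := Coalgebra.coassoc
  counit_coact := by
    rw [Coalgebra.lTensor_counit_comp_comul]; ext; simp

/-- The direct sum of `n` copies of a right comodule, with componentwise coaction. -/
abbrev pow (M : RightComodule K C) (n : ℕ) : RightComodule K C where
  carrier := Fin n → M.carrier
  coact := ∑ i : Fin n, (LinearMap.single K (fun _ : Fin n => M.carrier) i).rTensor C ∘ₗ
    M.coact ∘ₗ LinearMap.proj i
  coassoc := by
    apply LinearMap.pi_ext'
    intro i
    have h : (∑ j : Fin n, (LinearMap.single K (fun _ : Fin n => M.carrier) j).rTensor C ∘ₗ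
        M.coact ∘ₗ LinearMap.proj j) ∘ₗ LinearMap.single K (fun _ : Fin n => M.carrier) i =
        (LinearMap.single K (fun _ : Fin n => M.carrier) i).rTensor C ∘ₗ M.coact := by
      ext m
      simp only [LinearMap.comp_apply, LinearMap.sum_apply, LinearMap.proj_apply,
        LinearMap.single_apply]
      rw [Finset.sum_eq_single i (fun j _ hj => by simp [Pi.single_eq_of_ne hj]) (by simp)]
      simp
    have h1 : (TensorProduct.assoc K (Fin n → M.carrier) C C).toLinearMap ∘ₗ
        ((LinearMap.single K (fun _ : Fin n => M.carrier) i).rTensor C).rTensor C =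
        (LinearMap.single K (fun _ : Fin n => M.carrier) i).rTensor (C ⊗[K] C) ∘ₗ
        (TensorProduct.assoc K M.carrier C C).toLinearMap := by
      apply TensorProduct.ext_threefold
      intros; simp
    rw [LinearMap.comp_assoc, LinearMap.comp_assoc, LinearMap.comp_assoc, h,
      ← LinearMap.comp_assoc M.coact, ← LinearMap.rTensor_comp, h,
      LinearMap.rTensor_comp, LinearMap.comp_assoc, ← LinearMap.comp_assoc, h1,
      LinearMap.comp_assoc, M.coassoc, ← LinearMap.comp_assoc, ← LinearMap.comp_assoc,
      LinearMap.rTensor_comp_lTensor, LinearMap.lTensor_comp_rTensor]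
  counit_coact := by
    apply LinearMap.pi_ext'
    intro i
    have h : (∑ j : Fin n, (LinearMap.single K (fun _ : Fin n => M.carrier) j).rTensor C ∘ₗ
        M.coact ∘ₗ LinearMap.proj j) ∘ₗ LinearMap.single K (fun _ : Fin n => M.carrier) i =
        (LinearMap.single K (fun _ : Fin n => M.carrier) i).rTensor C ∘ₗ M.coact := by
      ext m
      simp only [LinearMap.comp_apply, LinearMap.sum_apply, LinearMap.proj_apply,
        LinearMap.single_apply]
      rw [Finset.sum_eq_single i (fun j _ hj => by simp [Pi.single_eq_of_ne hj]) (by simp)]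
      simp
    have h1 : (TensorProduct.rid K (Fin n → M.carrier)).toLinearMap ∘ₗ
        (Coalgebra.counit (R := K) (A := C)).lTensor (Fin n → M.carrier) ∘ₗ
        (LinearMap.single K (fun _ : Fin n => M.carrier) i).rTensor C =
        LinearMap.single K (fun _ : Fin n => M.carrier) i ∘ₗ
        (TensorProduct.rid K M.carrier).toLinearMap ∘ₗ
        (Coalgebra.counit (R := K) (A := C)).lTensor M.carrier := by
      apply TensorProduct.ext'
      intros; simp [← Pi.single_smul]
    rw [LinearMap.comp_assoc, LinearMap.comp_assoc, h, ← LinearMap.comp_assoc,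
      ← LinearMap.comp_assoc, LinearMap.comp_assoc (LinearMap.rTensor C _), h1,
      LinearMap.comp_assoc, LinearMap.comp_assoc, M.counit_coact, LinearMap.comp_id,
      LinearMap.id_comp]

/-- The `D`-comodule obtained from a right `C`-comodule by corestriction along a coalgebra map
`f : C → D`: the same vector space with the coaction `m ↦ m₀ ⊗ f(m₁)`. -/
abbrev corestrictObj (f : C →ₗc[K] D) (M : RightComodule K C) : RightComodule K D where
  carrier := M.carrier
  coact := f.toLinearMap.lTensor M.carrier ∘ₗ M.coact
  coassoc := by
    have h1 : (TensorProduct.assoc K M.carrier D D).toLinearMap ∘ₗ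
        (f.toLinearMap.lTensor M.carrier ∘ₗ M.coact).rTensor D ∘ₗ
        f.toLinearMap.lTensor M.carrier =
        (TensorProduct.map f.toLinearMap f.toLinearMap).lTensor M.carrier ∘ₗ
        (TensorProduct.assoc K M.carrier C C).toLinearMap ∘ₗ M.coact.rTensor C := by
      apply TensorProduct.ext'
      intro m c
      simp only [LinearMap.comp_apply, LinearMap.lTensor_tmul, LinearMap.rTensor_tmul]
      induction M.coact m using TensorProduct.induction_on with
      | zero => simp
      | tmul x y => simp
      | add x y hx hy => simp only [map_add, TensorProduct.add_tmul, hx, hy]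
    rw [← LinearMap.comp_assoc, ← LinearMap.comp_assoc,
      LinearMap.comp_assoc (LinearMap.lTensor M.carrier f.toLinearMap), h1,
      LinearMap.comp_assoc, LinearMap.comp_assoc, M.coassoc, ← LinearMap.comp_assoc,
      ← LinearMap.comp_assoc, ← LinearMap.lTensor_comp, ← LinearMap.lTensor_comp,
      f.map_comp_comul]
  counit_coact := by
    rw [← LinearMap.comp_assoc M.coact, ← LinearMap.lTensor_comp,
      f.counit_comp, M.counit_coact]

/-- The corestriction functor along a coalgebra map `f : C → D`, which keeps the underlying linear
maps. -/
abbrev corestrict (f : C →ₗc[K] D) : RightComodule K C ⥤ RightComodule K D where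
  obj M := corestrictObj f M
  map {M N} g :=
    { toLinearMap := g.toLinearMap
      comm := by
        change (f.toLinearMap.lTensor N.carrier ∘ₗ N.coact) ∘ₗ g.toLinearMap =
          g.toLinearMap.rTensor D ∘ₗ f.toLinearMap.lTensor M.carrier ∘ₗ M.coact
        rw [LinearMap.comp_assoc, g.comm, ← LinearMap.comp_assoc, ← LinearMap.comp_assoc,
          LinearMap.lTensor_comp_rTensor, LinearMap.rTensor_comp_lTensor] }

/-- A right `C`-comodule is finitely cogenerated if it embeds into `Cⁿ` for some natural
number `n`. -/
def IsFinitelyCogenerated (M : RightComodule K C) : Prop :=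
  ∃ (n : ℕ) (f : M ⟶ (regular K C).pow n), Function.Injective f.toLinearMap

end RightComodule

end RightComodules

section LeftComodules

/-- Left comodules over the `K`-coalgebra `C`. -/
structure LeftComodule (K C : Type u) [Field K] [AddCommGroup C] [Module K C]
    [Coalgebra K C] where
  carrier : Type u
  [addCommGroup : AddCommGroup carrier]
  [module : Module K carrier]
  /-- the coaction `m ↦ m₋₁ ⊗ m₀` -/
  coact : carrier →ₗ[K] C ⊗[K] carrier
  coassoc : (TensorProduct.assoc K C C carrier).toLinearMap ∘ₗ
      (Coalgebra.comul (R := K) (A := C)).rTensor carrier ∘ₗ coact =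
    coact.lTensor C ∘ₗ coact
  counit_coact : (TensorProduct.lid K carrier).toLinearMap ∘ₗ
    (Coalgebra.counit (R := K) (A := C)).rTensor carrier ∘ₗ coact = LinearMap.id

attribute [instance] LeftComodule.addCommGroup LeftComodule.module

namespace LeftComodule

variable {K C D : Type u} [Field K] [AddCommGroup C] [Module K C] [Coalgebra K C]
  [AddCommGroup D] [Module K D] [Coalgebra K D]

/-- Morphisms of left comodules: linear maps `f` with `f(m)₋₁ ⊗ f(m)₀ = m₋₁ ⊗ f(m₀)`. -/
@[ext]
structure Hom (M N : LeftComodule K C) where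
  toLinearMap : M.carrier →ₗ[K] N.carrier
  comm : N.coact ∘ₗ toLinearMap = toLinearMap.lTensor C ∘ₗ M.coact

/-- The category of left `C`-comodules. -/
instance : Category (LeftComodule K C) where
  Hom := Hom
  id M := ⟨LinearMap.id, by simp⟩
  comp f g := ⟨g.toLinearMap ∘ₗ f.toLinearMap, by
    rw [← LinearMap.comp_assoc, g.comm, LinearMap.comp_assoc, f.comm, LinearMap.lTensor_comp,
      LinearMap.comp_assoc]⟩

variable (K C) in
/-- `C` as a left comodule over itself, through its comultiplication. -/
abbrev regular : LeftComodule K C where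
  carrier := C
  coact := Coalgebra.comul
  coassoc := Coalgebra.coassoc
  counit_coact := by
    rw [Coalgebra.rTensor_counit_comp_comul]; ext; simp

/-- The direct sum of `n` copies of a left comodule, with componentwise coaction. -/
abbrev pow (M : LeftComodule K C) (n : ℕ) : LeftComodule K C where
  carrier := Fin n → M.carrier
  coact := ∑ i : Fin n, (LinearMap.single K (fun _ : Fin n => M.carrier) i).lTensor C ∘ₗ
    M.coact ∘ₗ LinearMap.proj i
  coassoc := by
    apply LinearMap.pi_ext'
    intro i
    have h : (∑ j : Fin n, (LinearMap.single K (fun _ : Fin n => M.carrier) j).lTensor C ∘ₗ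
        M.coact ∘ₗ LinearMap.proj j) ∘ₗ LinearMap.single K (fun _ : Fin n => M.carrier) i =
        (LinearMap.single K (fun _ : Fin n => M.carrier) i).lTensor C ∘ₗ M.coact := by
      ext m
      simp only [LinearMap.comp_apply, LinearMap.sum_apply, LinearMap.proj_apply,
        LinearMap.single_apply]
      rw [Finset.sum_eq_single i (fun j _ hj => by simp [Pi.single_eq_of_ne hj]) (by simp)]
      simp
    have h1 : (TensorProduct.assoc K C C (Fin n → M.carrier)).toLinearMap ∘ₗ
        (LinearMap.single K (fun _ : Fin n => M.carrier) i).lTensor (C ⊗[K] C) =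
        ((LinearMap.single K (fun _ : Fin n => M.carrier) i).lTensor C).lTensor C ∘ₗ
        (TensorProduct.assoc K C C M.carrier).toLinearMap := by
      apply TensorProduct.ext_threefold
      intros; simp
    rw [LinearMap.comp_assoc, LinearMap.comp_assoc, LinearMap.comp_assoc, h,
      ← LinearMap.comp_assoc M.coact (LinearMap.lTensor _ _), LinearMap.rTensor_comp_lTensor,
      ← LinearMap.lTensor_comp_rTensor, LinearMap.comp_assoc, ← LinearMap.comp_assoc, h1,
      LinearMap.comp_assoc, M.coassoc, ← LinearMap.comp_assoc, ← LinearMap.comp_assoc,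
      ← LinearMap.lTensor_comp, ← LinearMap.lTensor_comp, h]
  counit_coact := by
    apply LinearMap.pi_ext'
    intro i
    have h : (∑ j : Fin n, (LinearMap.single K (fun _ : Fin n => M.carrier) j).lTensor C ∘ₗ
        M.coact ∘ₗ LinearMap.proj j) ∘ₗ LinearMap.single K (fun _ : Fin n => M.carrier) i =
        (LinearMap.single K (fun _ : Fin n => M.carrier) i).lTensor C ∘ₗ M.coact := by
      ext m
      simp only [LinearMap.comp_apply, LinearMap.sum_apply, LinearMap.proj_apply,
        LinearMap.single_apply]
      rw [Finset.sum_eq_single i (fun j _ hj => by simp [Pi.single_eq_of_ne hj]) (by simp)]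
      simp
    have h1 : (TensorProduct.lid K (Fin n → M.carrier)).toLinearMap ∘ₗ
        (Coalgebra.counit (R := K) (A := C)).rTensor (Fin n → M.carrier) ∘ₗ
        (LinearMap.single K (fun _ : Fin n => M.carrier) i).lTensor C =
        LinearMap.single K (fun _ : Fin n => M.carrier) i ∘ₗ
        (TensorProduct.lid K M.carrier).toLinearMap ∘ₗ
        (Coalgebra.counit (R := K) (A := C)).rTensor M.carrier := by
      apply TensorProduct.ext'
      intros; simp [← Pi.single_smul]
    rw [LinearMap.comp_assoc, LinearMap.comp_assoc, h, ← LinearMap.comp_assoc,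
      ← LinearMap.comp_assoc, LinearMap.comp_assoc (LinearMap.lTensor C _), h1,
      LinearMap.comp_assoc, LinearMap.comp_assoc, M.counit_coact, LinearMap.comp_id,
      LinearMap.id_comp]

/-- The `D`-comodule obtained from a left `C`-comodule by corestriction along a coalgebra map
`f : C → D`: the same vector space with the coaction `m ↦ f(m₋₁) ⊗ m₀`. -/
abbrev corestrictObj (f : C →ₗc[K] D) (M : LeftComodule K C) : LeftComodule K D where
  carrier := M.carrier
  coact := f.toLinearMap.rTensor M.carrier ∘ₗ M.coact
  coassoc := by
    have h1 : (f.toLinearMap.rTensor M.carrier ∘ₗ M.coact).lTensor D ∘ₗ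
        f.toLinearMap.rTensor M.carrier =
        (TensorProduct.assoc K D D M.carrier).toLinearMap ∘ₗ
        (TensorProduct.map f.toLinearMap f.toLinearMap).rTensor M.carrier ∘ₗ
        (TensorProduct.assoc K C C M.carrier).symm.toLinearMap ∘ₗ M.coact.lTensor C := by
      apply TensorProduct.ext'
      intro c m
      simp only [LinearMap.comp_apply, LinearMap.lTensor_tmul, LinearMap.rTensor_tmul]
      induction M.coact m using TensorProduct.induction_on with
      | zero => simp
      | tmul x y => simp
      | add x y hx hy => simp only [map_add, TensorProduct.tmul_add, hx, hy]
    have h2 : (TensorProduct.assoc K C C M.carrier).symm.toLinearMap ∘ₗ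
        M.coact.lTensor C ∘ₗ M.coact =
        (Coalgebra.comul (R := K) (A := C)).rTensor M.carrier ∘ₗ M.coact := by
      rw [← M.coassoc]; ext; simp
    rw [← LinearMap.comp_assoc M.coact _ (LinearMap.lTensor D _), h1,
      ← LinearMap.comp_assoc M.coact, ← LinearMap.rTensor_comp, ← f.map_comp_comul,
      LinearMap.rTensor_comp]
    simp only [LinearMap.comp_assoc, h2]
  counit_coact := by
    rw [← LinearMap.comp_assoc M.coact, ← LinearMap.rTensor_comp,
      f.counit_comp, M.counit_coact]

/-- The corestriction functor along a coalgebra map `f : C → D`, which keeps the underlying linear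
maps. -/
abbrev corestrict (f : C →ₗc[K] D) : LeftComodule K C ⥤ LeftComodule K D where
  obj M := corestrictObj f M
  map {M N} g :=
    { toLinearMap := g.toLinearMap
      comm := by
        change (f.toLinearMap.rTensor N.carrier ∘ₗ N.coact) ∘ₗ g.toLinearMap =
          g.toLinearMap.lTensor D ∘ₗ f.toLinearMap.rTensor M.carrier ∘ₗ M.coact
        rw [LinearMap.comp_assoc, g.comm, ← LinearMap.comp_assoc, ← LinearMap.comp_assoc,
          LinearMap.lTensor_comp_rTensor, LinearMap.rTensor_comp_lTensor] }

/-- A left `C`-comodule is finitely cogenerated if it embeds into `Cⁿ` for some natural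
number `n`. -/
def IsFinitelyCogenerated (M : LeftComodule K C) : Prop :=
  ∃ (n : ℕ) (f : M ⟶ (regular K C).pow n), Function.Injective f.toLinearMap

end LeftComodule

end LeftComodules

/-- A coalgebra map `f : C → D` is a Frobenius extension of coalgebras if the corestriction
functor from right `C`-comodules to right `D`-comodules is a Frobenius functor. -/
def IsFrobeniusCoalgebraExtension {K C D : Type u} [Field K] [AddCommGroup C] [Module K C]
    [Coalgebra K C] [AddCommGroup D] [Module K D] [Coalgebra K D] (f : C →ₗc[K] D) : Prop :=
  IsFrobeniusFunctor (RightComodule.corestrict f)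

section Rings

variable {A B : Type*} [Ring A] [Ring B]

/-- `B` as a right `A`-module through `φ : A → B`: `b · a = b φ(a)`, written as a module over the
opposite ring of `A`. -/
abbrev rightModuleOfRingHom (φ : A →+* B) : Module Aᵐᵒᵖ B :=
  Module.compHom B φ.op

/-- Through `φ : A → B`, the ring `B` is a finitely generated projective left `A`-module. -/
def IsLeftFGProjective (φ : A →+* B) : Prop :=
  letI : Module A B := Module.compHom B φ
  Module.Finite A B ∧ Module.Projective A B

/-- Through `φ : A → B`, the ring `B` is a finitely generated projective right `A`-module. -/
def IsRightFGProjective (φ : A →+* B) : Prop :=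
  letI : Module Aᵐᵒᵖ B := rightModuleOfRingHom φ
  Module.Finite Aᵐᵒᵖ B ∧ Module.Projective Aᵐᵒᵖ B

/-- A ring homomorphism `φ : A → B` is a Frobenius extension if `B` is a finitely generated
projective left `A`-module and `B` is isomorphic to `Hom_A(B, A)` (left `A`-linear maps) as a
`(B, A)`-bimodule, where `(b · g)(x) = g(x b)` and `(g · a)(x) = g(x) a`. -/
def IsFrobeniusRingExtension (φ : A →+* B) : Prop :=
  IsLeftFGProjective φ ∧
    letI : Module A B := Module.compHom B φ
    ∃ Φ : B ≃+ (B →ₗ[A] A),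
      (∀ b c x : B, Φ (b * c) x = Φ c (x * b)) ∧
      ∀ (c : B) (a : A) (x : B), Φ (c * φ a) x = Φ c x * a

end Rings

/-- The dual algebra homomorphism `f* : D* → C*`, `g ↦ g ∘ f`, of a coalgebra map `f : C → D`,
where the dual spaces carry the convolution product `(g * h)(c) = g(c₁) h(c₂)` with unit the
counit. -/
def dualAlgHom {K C D : Type u} [Field K] [AddCommGroup C] [Module K C]
    [Coalgebra K C] [AddCommGroup D] [Module K D] [Coalgebra K D] (f : C →ₗc[K] D) :
    WithConv (D →ₗ[K] K) →ₐ[K] WithConv (C →ₗ[K] K) where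
  toFun g := WithConv.toConv (g.ofConv ∘ₗ f.toLinearMap)
  map_one' := by
    ext c
    simp [LinearMap.convOne_def]
  map_mul' g h := by
    exact WithConv.ext (LinearMap.convMul_comp_coalgHom_distrib g h f)
  map_zero' := rfl
  map_add' _ _ := rfl
  commutes' k := by
    ext c
    simp

/-! ### Frobenius systems: the bimodule form of a Frobenius extension and its form by dual bases. -/

section FrobeniusSystems

variable {A B : Type*} [Ring A] [Ring B]

/-! Write `φ = f* : D* → C*`. Everything passes through a Frobenius system `(E, xᵢ, yᵢ)` for `φ`.
For rings its existence is the usual reformulation of the bimodule isomorphism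
(`isFrobeniusRingExtension_iff`). For comodules one reads coactions as actions of the dual algebra;
over a field this loses nothing, since functionals separate tensors (`RightComodule.homOfAct`).

As `C` is finite-dimensional, every `C*`-module is a `C`-comodule. Hence `N ↦ Hom_{D*}(C*, N)` is a
right adjoint of corestriction for arbitrary `D`, and corestriction is Frobenius exactly when this
functor is also its left adjoint. A Frobenius system gives the required unit `n ↦ (b ↦ E(b) · n)`
and counit `g ↦ ∑ xᵢ · g(yᵢ)`. Conversely, by naturality along the coefficient maps into the regular
comodules, every unit and counit has this form; the triangle identities are then the two dual basis
identities (`RightComodule.nonempty_frobeniusSystem_of_adjunction`).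

For the supplement, the dual basis identities present `C*` as a direct summand of `(D*)ⁿ` on both
sides. Since `E` is induced by a linear map `D → C`, the same identities transpose to present `C` as
a direct summand of `Dⁿ`, on the left and on the right. -/

/-- A Frobenius system for a ring homomorphism `φ : A → B`: an `A`-bimodule map `E : B → A` and
dual bases `x`, `y` with `∑ E(b xᵢ) yᵢ = b = ∑ xᵢ E(yᵢ b)`. -/
structure FrobeniusSystem (φ : A →+* B) where
  functional : B →+ A
  map_mul_left : ∀ a b, functional (φ a * b) = a * functional b
  map_mul_right : ∀ b a, functional (b * φ a) = functional b * a
  size : ℕ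
  x : Fin size → B
  y : Fin size → B
  sum_left : ∀ b, ∑ i, φ (functional (b * x i)) * y i = b
  sum_right : ∀ b, ∑ i, x i * φ (functional (y i * b)) = b

namespace FrobeniusSystem

variable {φ : A →+* B}

/-- The coordinates `b ↦ E(b xⱼ)` split the map `Aⁿ → B` given by the `yⱼ`. The right-handed version
exchanges the roles of `x` and `y`. -/
theorem isLeftFGProjective (S : FrobeniusSystem φ) : IsLeftFGProjective φ := by
  let _ : Module A B := Module.compHom B φ
  have smul_def (a : A) (b : B) : a • b = φ a * b := rfl
  let i : B →ₗ[A] (Fin S.size → A) :=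
    { toFun := fun b j => S.functional (b * S.x j)
      map_add' := fun b c => by ext j; simp [add_mul]
      map_smul' := fun a b => by ext j; simp [smul_def, mul_assoc, S.map_mul_left] }
  let s : (Fin S.size → A) →ₗ[A] B := Fintype.linearCombination A S.y
  have h : s ∘ₗ i = LinearMap.id := by
    ext b
    simpa [s, i, Fintype.linearCombination_apply, smul_def] using S.sum_left b
  exact ⟨Module.Finite.of_surjective s fun b => ⟨i b, LinearMap.congr_fun h b⟩,
    Module.Projective.of_split i s h⟩

theorem isRightFGProjective (S : FrobeniusSystem φ) : IsRightFGProjective φ := by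
  let _ : Module Aᵐᵒᵖ B := rightModuleOfRingHom φ
  have smul_def (a : Aᵐᵒᵖ) (b : B) : a • b = b * φ a.unop := rfl
  let i : B →ₗ[Aᵐᵒᵖ] (Fin S.size → Aᵐᵒᵖ) :=
    { toFun := fun b j => MulOpposite.op (S.functional (S.y j * b))
      map_add' := fun b c => by ext j; simp [mul_add]
      map_smul' := fun a b => by ext j; simp [smul_def, ← mul_assoc, S.map_mul_right] }
  let s : (Fin S.size → Aᵐᵒᵖ) →ₗ[Aᵐᵒᵖ] B := Fintype.linearCombination Aᵐᵒᵖ S.x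
  have h : s ∘ₗ i = LinearMap.id := by
    ext b
    simpa [s, i, Fintype.linearCombination_apply, smul_def] using S.sum_right b
  exact ⟨Module.Finite.of_surjective s fun b => ⟨i b, LinearMap.congr_fun h b⟩,
    Module.Projective.of_split i s h⟩

/-- The isomorphism is `b ↦ E(- b)`, with inverse `g ↦ ∑ xᵢ φ(g(yᵢ))`. -/
theorem isFrobeniusRingExtension (S : FrobeniusSystem φ) : IsFrobeniusRingExtension φ := by
  refine ⟨S.isLeftFGProjective, ?_⟩
  let _ : Module A B := Module.compHom B φ
  have smul_def (a : A) (b : B) : a • b = φ a * b := rfl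
  let F : B →+ (B →ₗ[A] A) :=
    { toFun := fun b =>
        { toFun := fun x => S.functional (x * b)
          map_add' := fun x y => by simp [add_mul]
          map_smul' := fun a x => by simp [smul_def, mul_assoc, S.map_mul_left] }
      map_zero' := by ext; simp
      map_add' := fun b c => by ext x; simp [mul_add] }
  have F_apply (b x : B) : F b x = S.functional (x * b) := rfl
  have hF : Function.Bijective F := by
    constructor
    · rw [injective_iff_map_eq_zero]
      intro b hb
      rw [← S.sum_right b]
      simp [← F_apply, hb]
    · intro g
      refine ⟨∑ i, S.x i * φ (g (S.y i)), ?_⟩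
      ext x
      conv_rhs => rw [← S.sum_left x]
      rw [F_apply, Finset.mul_sum, map_sum, map_sum]
      refine Finset.sum_congr rfl fun i _ => ?_
      rw [← mul_assoc, S.map_mul_right, ← smul_def, map_smul, smul_eq_mul]
  refine ⟨AddEquiv.ofBijective F hF, fun b c x => ?_, fun c a x => ?_⟩
  · simp [F_apply, mul_assoc]
  · simp [F_apply, ← mul_assoc, S.map_mul_right]

end FrobeniusSystem

/-- Take `E = Φ 1`, so that `Φ b = E(- b)`. The `yᵢ` generate `B`, and `xᵢ` represents the `i`-th
coordinate of a splitting of `Aⁿ → B`. -/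
theorem IsFrobeniusRingExtension.nonempty_frobeniusSystem {φ : A →+* B}
    (h : IsFrobeniusRingExtension φ) : Nonempty (FrobeniusSystem φ) := by
  let _ : Module A B := Module.compHom B φ
  have smul_def (a : A) (b : B) : a • b = φ a * b := rfl
  obtain ⟨⟨hfin, hproj⟩, Φ, hΦl, hΦr⟩ := h
  have hE (b x : B) : Φ b x = Φ 1 (x * b) := by rw [← hΦl, mul_one]
  obtain ⟨n, p, hp⟩ := Module.Finite.exists_fin' A B
  obtain ⟨s, hs⟩ := Module.projective_lifting_property p LinearMap.id hp
  let y (i : Fin n) : B := p (Pi.single i 1)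
  let x (i : Fin n) : B := Φ.symm (LinearMap.proj i ∘ₗ s)
  have hleft (b : B) : ∑ i, φ (Φ 1 (b * x i)) * y i = b := by
    have h1 (i : Fin n) : Φ 1 (b * x i) = s b i := by rw [← hE]; simp [x]
    simp_rw [h1, y, ← smul_def, ← map_smul, ← map_sum]
    have h2 : ∑ i, s b i • Pi.single i (1 : A) = s b := by
      ext j; simp [Finset.sum_apply, Pi.single_apply]
    rw [h2]
    exact LinearMap.congr_fun hs b
  -- Both bimodule rules are used here, through `φ a * 1 = 1 * φ a`.
  have hmulr (b : B) (a : A) : Φ 1 (b * φ a) = Φ 1 b * a := by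
    rw [← hE, ← hΦr, one_mul]
  refine ⟨⟨(Φ 1).toAddMonoidHom, fun a b => ?_, hmulr, n, x, y, hleft, fun b => ?_⟩⟩
  · exact (Φ 1).map_smul a b
  · apply Φ.injective
    ext z
    rw [hE, hE b]
    conv_rhs => rw [← hleft z]
    simp_rw [Finset.mul_sum, Finset.sum_mul, map_sum]
    refine Finset.sum_congr rfl fun i _ => ?_
    rw [← mul_assoc, mul_assoc (φ _), ← smul_def, map_smul, smul_eq_mul]
    exact hmulr _ _

theorem isFrobeniusRingExtension_iff (φ : A →+* B) :
    IsFrobeniusRingExtension φ ↔ Nonempty (FrobeniusSystem φ) :=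
  ⟨fun h => h.nonempty_frobeniusSystem, fun ⟨S⟩ => S.isFrobeniusRingExtension⟩

end FrobeniusSystems

/-! ### Functionals separate vectors and tensors. -/

section Separation

variable {K V W : Type*} [Field K] [AddCommGroup V] [Module K V] [AddCommGroup W] [Module K W]

theorem eq_of_forall_dual_apply_eq {v w : V} (h : ∀ b : V →ₗ[K] K, b v = b w) : v = w := by
  rw [← sub_eq_zero, ← Module.forall_dual_apply_eq_zero_iff K]
  intro b
  rw [map_sub, h, sub_self]

/-- The coefficients of a tensor along a basis of `W` are its slices by the coordinate functionals.
-/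
theorem TensorProduct.eq_of_forall_lTensor_dual_eq {s t : V ⊗[K] W}
    (h : ∀ b : W →ₗ[K] K, b.lTensor V s = b.lTensor V t) : s = t := by
  classical
  apply (TensorProduct.equivFinsuppOfBasisRight (M := V) (Module.Basis.ofVectorSpace K W)).injective
  ext i
  have key (z : V ⊗[K] W) : TensorProduct.equivFinsuppOfBasisRight
      (M := V) (Module.Basis.ofVectorSpace K W) z i =
      TensorProduct.rid K V (((Module.Basis.ofVectorSpace K W).coord i).lTensor V z) := by
    induction z using TensorProduct.induction_on with
    | zero => simp
    | tmul x y => simp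
    | add x y hx hy => simp [hx, hy]
  rw [key, key, h]

theorem TensorProduct.eq_of_forall_rTensor_dual_eq {s t : W ⊗[K] V}
    (h : ∀ b : W →ₗ[K] K, b.rTensor V s = b.rTensor V t) : s = t := by
  apply (TensorProduct.comm K W V).injective
  apply TensorProduct.eq_of_forall_lTensor_dual_eq
  intro b
  have := congrArg (TensorProduct.comm K K V) (h b)
  simpa only [LinearMap.rTensor, LinearMap.lTensor, ← TensorProduct.map_comm] using this

end Separation

theorem TensorProduct.lid_rTensor_lTensor {K C V : Type*} [Field K] [AddCommGroup C]
    [Module K C] [AddCommGroup V] [Module K V] (r : V →ₗ[K] C ⊗[K] V)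
    (a b : C →ₗ[K] K) (t : C ⊗[K] V) :
    TensorProduct.lid K V (b.rTensor V (TensorProduct.lid K _
      (a.rTensor (C ⊗[K] V) (r.lTensor C t)))) =
      TensorProduct.lid K V (b.rTensor V (r (TensorProduct.lid K V (a.rTensor V t)))) := by
  induction t using TensorProduct.induction_on with
  | zero => simp
  | tmul x y => simp
  | add x y hx hy => simp only [map_add, hx, hy]

/-- The dual algebra of a coalgebra, with the convolution product. -/
abbrev ConvDual (K C : Type*) [Field K] [AddCommGroup C] [Module K C] :=
  WithConv (C →ₗ[K] K)

/-! ### Right comodules as left modules over the dual algebra. -/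

namespace RightComodule

variable {K C D : Type u} [Field K] [AddCommGroup C] [Module K C] [Coalgebra K C]
  [AddCommGroup D] [Module K D] [Coalgebra K D]

theorem hom_ext {M N : RightComodule K C} {f g : M ⟶ N}
    (h : ∀ m, f.toLinearMap m = g.toLinearMap m) : f = g :=
  Hom.ext (LinearMap.ext h)

/-- The linear map `m ↦ b(m₁) m₀`. -/
def actLinear (M : RightComodule K C) (b : C →ₗ[K] K) : M.carrier →ₗ[K] M.carrier :=
  (TensorProduct.rid K M.carrier).toLinearMap ∘ₗ b.lTensor M.carrier ∘ₗ M.coact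

theorem actLinear_convMul (M : RightComodule K C) (a b : ConvDual K C) :
    M.actLinear (a * b).ofConv = M.actLinear a.ofConv ∘ₗ M.actLinear b.ofConv := by
  have h1 : (TensorProduct.rid K M.carrier).toLinearMap ∘ₗ
      (a * b).ofConv.lTensor M.carrier =
      ((TensorProduct.rid K M.carrier).toLinearMap ∘ₗ
        (LinearMap.mul' K K ∘ₗ TensorProduct.map a.ofConv b.ofConv).lTensor M.carrier) ∘ₗ
        (Coalgebra.comul (R := K) (A := C)).lTensor M.carrier := by
    rw [LinearMap.comp_assoc, ← LinearMap.lTensor_comp, LinearMap.convMul_def]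
    rfl
  have h2 : ((TensorProduct.rid K M.carrier).toLinearMap ∘ₗ
        (LinearMap.mul' K K ∘ₗ TensorProduct.map a.ofConv b.ofConv).lTensor M.carrier) ∘ₗ
      (TensorProduct.assoc K M.carrier C C).toLinearMap ∘ₗ M.coact.rTensor C =
      M.actLinear a.ofConv ∘ₗ (TensorProduct.rid K M.carrier).toLinearMap ∘ₗ
        b.ofConv.lTensor M.carrier := by
    apply TensorProduct.ext'
    intro m c
    simp only [actLinear, LinearMap.comp_apply, LinearMap.lTensor_tmul, LinearMap.rTensor_tmul,
      LinearEquiv.coe_coe, TensorProduct.rid_tmul, map_smul]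
    induction M.coact m using TensorProduct.induction_on with
    | zero => simp
    | tmul x y => simp [smul_smul, mul_comm]
    | add x y hx hy => simp only [map_add, TensorProduct.add_tmul, hx, hy, smul_add]
  calc M.actLinear (a * b).ofConv
      = ((TensorProduct.rid K M.carrier).toLinearMap ∘ₗ
          (a * b).ofConv.lTensor M.carrier) ∘ₗ M.coact := rfl
    _ = _ := by
      rw [h1, LinearMap.comp_assoc, ← M.coassoc, ← LinearMap.comp_assoc M.coact,
        ← LinearMap.comp_assoc M.coact, h2]
      rfl

/-- The left action `b · m = m₀ b(m₁)` of the dual algebra on a right comodule. -/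
noncomputable def act (M : RightComodule K C) : ConvDual K C →ₐ[K] Module.End K M.carrier :=
  AlgHom.ofLinearMap
    { toFun := fun b => M.actLinear b.ofConv
      map_add' := fun a b => by
        simp [actLinear, LinearMap.lTensor_add, LinearMap.add_comp, LinearMap.comp_add]
      map_smul' := fun k b => by
        simp [actLinear, LinearMap.lTensor_smul, LinearMap.smul_comp, LinearMap.comp_smul] }
    (M.counit_coact) (fun a b => M.actLinear_convMul a b)

theorem act_apply (M : RightComodule K C) (b : ConvDual K C) (m : M.carrier) :
    M.act b m = TensorProduct.rid K M.carrier (b.ofConv.lTensor M.carrier (M.coact m)) := rfl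

theorem act_mul_apply (M : RightComodule K C) (a b : ConvDual K C) (m : M.carrier) :
    M.act (a * b) m = M.act a (M.act b m) := by rw [map_mul]; rfl

theorem act_one_apply (M : RightComodule K C) (m : M.carrier) : M.act 1 m = m := by
  rw [map_one]; rfl

theorem Hom.map_act {M N : RightComodule K C} (g : M ⟶ N) (b : ConvDual K C) (m : M.carrier) :
    g.toLinearMap (M.act b m) = N.act b (g.toLinearMap m) := by
  have := LinearMap.congr_fun g.comm m
  simp only [LinearMap.comp_apply] at this
  rw [act_apply, act_apply, this]
  induction M.coact m using TensorProduct.induction_on with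
  | zero => simp
  | tmul x y => simp
  | add x y hx hy => simp only [map_add, hx, hy]

/-- Over a field, linear maps commuting with the actions of the dual algebra are colinear. -/
def homOfAct {M N : RightComodule K C} (g : M.carrier →ₗ[K] N.carrier)
    (h : ∀ b m, g (M.act b m) = N.act b (g m)) : M ⟶ N where
  toLinearMap := g
  comm := by
    ext m
    apply TensorProduct.eq_of_forall_lTensor_dual_eq
    intro b
    apply (TensorProduct.rid K N.carrier).injective
    have := h (WithConv.toConv b) m
    rw [act_apply, act_apply] at this
    rw [LinearMap.comp_apply, ← WithConv.ofConv_toConv b, ← this, LinearMap.comp_apply]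
    generalize M.coact m = t
    induction t using TensorProduct.induction_on with
    | zero => simp
    | tmul x y => simp
    | add x y hx hy => simp only [map_add, hx, hy]

/-- The action on `C` is the transpose of right multiplication on `C*`, so identities in `C*`
transfer to `C`. -/
theorem dual_regular_act (a b : ConvDual K C) (c : C) :
    b.ofConv ((regular K C).act a c) = (b * a).ofConv c := by
  rw [act_apply, LinearMap.convMul_apply]
  change b.ofConv (TensorProduct.rid K C (a.ofConv.lTensor C (Coalgebra.comul c))) = _
  induction Coalgebra.comul (R := K) c using TensorProduct.induction_on with
  | zero => simp
  | tmul x y => simp [mul_comm]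
  | add x y hx hy => simp only [map_add, hx, hy]

theorem corestrict_act (f : C →ₗc[K] D) (M : RightComodule K C) (a : ConvDual K D)
    (m : M.carrier) : ((corestrict f).obj M).act a m = M.act (dualAlgHom f a) m := by
  rw [act_apply, act_apply]
  change TensorProduct.rid K M.carrier (a.ofConv.lTensor M.carrier
    (f.toLinearMap.lTensor M.carrier (M.coact m))) = _
  rw [← LinearMap.lTensor_comp_apply]
  rfl

/-- The colinear map `m ↦ p(m₀) m₁` defined by a functional `p`. -/
def coeffMap (M : RightComodule K C) (p : M.carrier →ₗ[K] K) : M ⟶ regular K C :=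
  homOfAct ((TensorProduct.lid K C).toLinearMap ∘ₗ p.rTensor C ∘ₗ M.coact) (by
    have key (b : ConvDual K C) (m : M.carrier) : b.ofConv
        (((TensorProduct.lid K C).toLinearMap ∘ₗ p.rTensor C ∘ₗ M.coact) m) = p (M.act b m) := by
      rw [act_apply, LinearMap.comp_apply, LinearMap.comp_apply]
      induction M.coact m using TensorProduct.induction_on with
      | zero => simp
      | tmul x y => simp [mul_comm]
      | add x y hx hy => simp only [map_add, hx, hy]
    intro a m
    apply eq_of_forall_dual_apply_eq (K := K)
    intro b
    exact (key (WithConv.toConv b) _).trans (by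
      rw [← act_mul_apply, ← key, ← dual_regular_act]))

theorem dual_coeffMap (M : RightComodule K C) (p : M.carrier →ₗ[K] K) (b : ConvDual K C)
    (m : M.carrier) : b.ofConv ((M.coeffMap p).toLinearMap m) = p (M.act b m) := by
  rw [act_apply]
  change b.ofConv (TensorProduct.lid K C (p.rTensor C (M.coact m))) = _
  induction M.coact m using TensorProduct.induction_on with
  | zero => simp
  | tmul x y => simp [mul_comm]
  | add x y hx hy => simp only [map_add, hx, hy]

/-- The counit recovers `p`: this is `dual_coeffMap` at the unit of the dual algebra. `C` is thus
cofree on `K`. -/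
theorem counit_coeffMap (M : RightComodule K C) (p : M.carrier →ₗ[K] K)
    (m : M.carrier) : Coalgebra.counit (R := K) ((M.coeffMap p).toLinearMap m) = p m := by
  conv_rhs => rw [← M.act_one_apply m, ← dual_coeffMap]
  rfl

/-- A linear map `V → V ⊗ C` is coassociative if it defines an action of the dual algebra. -/
theorem coassoc_of_convMul {V : Type*} [AddCommGroup V] [Module K V] (r : V →ₗ[K] V ⊗[K] C)
    (h : ∀ (a b : ConvDual K C) v, TensorProduct.rid K V ((a * b).ofConv.lTensor V (r v)) =
      TensorProduct.rid K V (a.ofConv.lTensor V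
        (r (TensorProduct.rid K V (b.ofConv.lTensor V (r v)))))) :
    (TensorProduct.assoc K V C C).toLinearMap ∘ₗ r.rTensor C ∘ₗ r =
      (Coalgebra.comul (R := K) (A := C)).lTensor V ∘ₗ r := by
  ext v
  -- Bracketed this way, the last factor can be sliced by `b` and then the middle one by `a`.
  apply (TensorProduct.assoc K V C C).symm.injective
  apply TensorProduct.eq_of_forall_lTensor_dual_eq
  intro b
  apply (TensorProduct.rid K _).injective
  apply TensorProduct.eq_of_forall_lTensor_dual_eq
  intro a
  apply (TensorProduct.rid K _).injective
  have h1 (t : V ⊗[K] C) : TensorProduct.rid K V (a.lTensor V (TensorProduct.rid K _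
      (b.lTensor (V ⊗[K] C) (r.rTensor C t)))) =
      TensorProduct.rid K V (a.lTensor V (r (TensorProduct.rid K V (b.lTensor V t)))) := by
    induction t using TensorProduct.induction_on with
    | zero => simp
    | tmul x y => simp
    | add x y hx hy => simp only [map_add, hx, hy]
  have h2 (t : V ⊗[K] C) : TensorProduct.rid K V (a.lTensor V (TensorProduct.rid K _
      (b.lTensor (V ⊗[K] C) ((TensorProduct.assoc K V C C).symm
        ((Coalgebra.comul (R := K) (A := C)).lTensor V t))))) =
      TensorProduct.rid K V
        ((WithConv.toConv a * WithConv.toConv b : ConvDual K C).ofConv.lTensor V t) := by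
    induction t using TensorProduct.induction_on with
    | zero => simp
    | tmul x y =>
      simp only [LinearMap.lTensor_tmul, LinearMap.convMul_apply]
      induction Coalgebra.comul (R := K) y using TensorProduct.induction_on with
      | zero => simp
      | tmul c d => simp [smul_smul, mul_comm]
      | add c d hc hd => simp only [map_add, TensorProduct.tmul_add, hc, hd]
    | add x y hx hy => simp only [map_add, hx, hy]
  simp only [LinearMap.comp_apply, LinearEquiv.coe_coe, LinearEquiv.symm_apply_apply]
  rw [h1, h2, h]

section OfAction

variable [FiniteDimensional K C] {V : Type u} [AddCommGroup V] [Module K V]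

/-- For finite-dimensional `C`, the coaction `v ↦ ∑ (eᵢ* · v) ⊗ eᵢ` defined by a module over the
dual algebra. -/
noncomputable def actionCoact (ρ : ConvDual K C →ₐ[K] Module.End K V) : V →ₗ[K] V ⊗[K] C :=
  ∑ i, (TensorProduct.mk K V C).flip (Module.finBasis K C i) ∘ₗ
    ρ (WithConv.toConv ((Module.finBasis K C).coord i))

/-- Expand `b` in the coordinate functionals; finite dimension of `C` makes them a basis of the
dual. -/
theorem rid_lTensor_actionCoact (ρ : ConvDual K C →ₐ[K] Module.End K V) (b : C →ₗ[K] K) (v : V) :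
    TensorProduct.rid K V (b.lTensor V (actionCoact ρ v)) = ρ (WithConv.toConv b) v := by
  have hb : WithConv.toConv b = ∑ i, b (Module.finBasis K C i) •
      WithConv.toConv ((Module.finBasis K C).coord i) := by
    apply WithConv.ext
    apply (Module.finBasis K C).ext
    intro j
    simp
  conv_rhs => rw [hb]
  simp [actionCoact]

/-- For finite-dimensional `C`, the right comodule defined by a left module over the dual
algebra. -/
noncomputable abbrev ofAction (ρ : ConvDual K C →ₐ[K] Module.End K V) : RightComodule K C where
  carrier := V
  coact := actionCoact ρ
  coassoc := coassoc_of_convMul _ fun a b v => by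
    simp only [rid_lTensor_actionCoact, WithConv.toConv_ofConv, map_mul]
    rfl
  counit_coact := by
    ext v
    change TensorProduct.rid K V (Coalgebra.counit.lTensor V (actionCoact ρ v)) = v
    rw [rid_lTensor_actionCoact]
    exact LinearMap.congr_fun (map_one ρ) v

theorem ofAction_act (ρ : ConvDual K C →ₐ[K] Module.End K V) (b : ConvDual K C) (v : V) :
    (ofAction ρ).act b v = ρ b v :=
  rid_lTensor_actionCoact ρ b.ofConv v

end OfAction

end RightComodule

/-! ### Coinduction, and its two adjunctions with corestriction. -/

namespace RightComodule

variable {K C D : Type u} [Field K] [AddCommGroup C] [Module K C] [Coalgebra K C]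
  [AddCommGroup D] [Module K D] [Coalgebra K D]

/-- The space of `D*`-linear maps from `C*` to a right `D`-comodule. -/
def coindSubmodule (f : C →ₗc[K] D) (N : RightComodule K D) :
    Submodule K (ConvDual K C →ₗ[K] N.carrier) where
  carrier := {g | ∀ a b, g (dualAlgHom f a * b) = N.act a (g b)}
  add_mem' := fun hg hh a b => by simp [hg a b, hh a b]
  zero_mem' := fun a b => by simp
  smul_mem' := fun k g hg a b => by simp [hg a b]

/-- The action `(c · g)(b) = g(bc)` of `C*` on the `D*`-linear maps from `C*`. -/
noncomputable def coindAct (f : C →ₗc[K] D) (N : RightComodule K D) :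
    ConvDual K C →ₐ[K] Module.End K (coindSubmodule f N) :=
  AlgHom.ofLinearMap
    { toFun := fun c =>
        { toFun := fun g => ⟨g.1 ∘ₗ LinearMap.mulRight K c, fun a b => by
            simpa [mul_assoc] using g.2 a (b * c)⟩
          map_add' := fun g h => rfl
          map_smul' := fun k g => rfl }
      map_add' := fun c d => by ext g b; simp [mul_add]
      map_smul' := fun k c => by ext g b; simp }
    (by ext g b; simp) (fun c d => by ext g b; simp [mul_assoc])

/-- A linear map `g : V → (C* → N)` with values in `D*`-linear maps. -/
def toCoind (f : C →ₗc[K] D) (N : RightComodule K D) {V : Type*} [AddCommGroup V] [Module K V]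
    (g : V →ₗ[K] ConvDual K C →ₗ[K] N.carrier)
    (h : ∀ v a b, g v (dualAlgHom f a * b) = N.act a (g v b)) : V →ₗ[K] coindSubmodule f N :=
  g.codRestrict (coindSubmodule f N) h

/-- The functional `E : C* → D*` of a Frobenius system, as a linear map. -/
noncomputable def functionalLinear (f : C →ₗc[K] D) (S : FrobeniusSystem (dualAlgHom f).toRingHom) :
    ConvDual K C →ₗ[K] ConvDual K D where
  toFun := S.functional
  map_add' := map_add S.functional
  map_smul' k b := by
    -- Homogeneity over `K` is left `D*`-linearity applied to scalars, which the algebra map fixes.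
    have h : (dualAlgHom f).toRingHom (algebraMap K _ k) = algebraMap K _ k :=
      (dualAlgHom f).commutes k
    refine (congrArg S.functional ((Algebra.smul_def k b).trans ?_)).trans
      ((S.map_mul_left (algebraMap K _ k) b).trans (Algebra.smul_def k _).symm)
    rw [h]

/-- The Casimir property `∑ xᵢ ⊗ yᵢ c = ∑ c xᵢ ⊗ yᵢ` over `D*`, evaluated through `g`. Both sides
expand to a double sum with coefficients `E(yⱼ c xᵢ)`. It makes the counit of the second adjunction
colinear. -/
theorem sum_act_comm (f : C →ₗc[K] D) (S : FrobeniusSystem (dualAlgHom f).toRingHom)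
    (M : RightComodule K C) (g : coindSubmodule f ((corestrict f).obj M)) (c : ConvDual K C) :
    ∑ i, M.act (S.x i) (g.1 (S.y i * c)) = M.act c (∑ i, M.act (S.x i) (g.1 (S.y i))) := by
  have h1 (j) : g.1 (S.y j * c) = ∑ i, M.act (dualAlgHom f (S.functional (S.y j * c * S.x i)))
      (g.1 (S.y i)) := by
    conv_lhs => rw [← S.sum_left (S.y j * c)]
    rw [map_sum]
    refine Finset.sum_congr rfl fun i _ => ?_
    rw [← corestrict_act]
    exact g.2 _ _
  have h2 (i) : M.act c (M.act (S.x i) (g.1 (S.y i))) = ∑ j, M.act (S.x j)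
      (M.act (dualAlgHom f (S.functional (S.y j * c * S.x i))) (g.1 (S.y i))) := by
    rw [← act_mul_apply]
    conv_lhs => rw [← S.sum_right (c * S.x i)]
    rw [map_sum, LinearMap.sum_apply]
    refine Finset.sum_congr rfl fun j _ => ?_
    rw [act_mul_apply, mul_assoc]
    rfl
  simp_rw [h1, map_sum, h2]
  exact Finset.sum_comm

variable [FiniteDimensional K C]

/-- Coinduction of comodules along a coalgebra map `f : C → D`, for finite-dimensional `C`. -/
noncomputable abbrev coind (f : C →ₗc[K] D) : RightComodule K D ⥤ RightComodule K C where
  obj N := ofAction (coindAct f N)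
  map {N P} h := homOfAct
    (toCoind f P (LinearMap.compRight K h.toLinearMap ∘ₗ (coindSubmodule f N).subtype)
      (fun g a b => (congrArg h.toLinearMap (g.2 a b)).trans (h.map_act _ _)))
    (fun b g => by rw [ofAction_act, ofAction_act]; rfl)

theorem coind_map_apply (f : C →ₗc[K] D) {N P : RightComodule K D} (h : N ⟶ P)
    (g : coindSubmodule f N) (b : ConvDual K C) :
    (((coind f).map h).toLinearMap g).1 b = h.toLinearMap (g.1 b) := rfl

theorem coind_act_apply (f : C →ₗc[K] D) (N : RightComodule K D) (c b : ConvDual K C)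
    (g : coindSubmodule f N) : (((coind f).obj N).act c g).1 b = g.1 (b * c) := by
  rw [ofAction_act]; rfl

/-- The unit `m ↦ (b ↦ b · m)` of the adjunction between corestriction and coinduction. -/
noncomputable def coindUnit (f : C →ₗc[K] D) (M : RightComodule K C) :
    M ⟶ (coind f).obj ((corestrict f).obj M) :=
  homOfAct (toCoind f ((corestrict f).obj M) M.act.toLinearMap.flip
    (fun m a b => by
      rw [corestrict_act]; exact M.act_mul_apply _ _ _))
    (fun c m => by
      apply Subtype.ext
      ext b
      rw [coind_act_apply]
      exact (M.act_mul_apply _ _ _).symm)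

theorem coindUnit_apply (f : C →ₗc[K] D) (M : RightComodule K C) (m : M.carrier)
    (b : ConvDual K C) : ((coindUnit f M).toLinearMap m).1 b = M.act b m := rfl

/-- The counit `g ↦ g(1)` of the adjunction between corestriction and coinduction. -/
noncomputable def coindCounit (f : C →ₗc[K] D) (N : RightComodule K D) :
    (corestrict f).obj ((coind f).obj N) ⟶ N :=
  homOfAct (LinearMap.applyₗ (1 : ConvDual K C) ∘ₗ (coindSubmodule f N).subtype)
    (fun a g => by
      rw [corestrict_act]
      refine (coind_act_apply f N _ _ g).trans ?_
      rw [one_mul, ← mul_one (dualAlgHom f a)]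
      exact g.2 a 1)

theorem coindCounit_apply (f : C →ₗc[K] D) (N : RightComodule K D) (g : coindSubmodule f N) :
    (coindCounit f N).toLinearMap g = g.1 1 := rfl

/-- Coinduction is right adjoint to corestriction. -/
noncomputable def corestrictCoindAdjunction (f : C →ₗc[K] D) : corestrict f ⊣ coind f where
  unit :=
    { app := coindUnit f
      naturality := fun M N g => by
        apply hom_ext
        intro m
        apply Subtype.ext
        ext b
        exact (g.map_act b m).symm }
  counit :=
    { app := coindCounit f
      naturality := fun M N g => by
        apply hom_ext
        intro m
        rfl }
  left_triangle_components M := by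
    apply hom_ext
    intro m
    change (coindCounit f ((corestrict f).obj M)).toLinearMap
      ((coindUnit f M).toLinearMap m) = m
    rw [coindCounit_apply, coindUnit_apply, act_one_apply]
  right_triangle_components N := by
    apply hom_ext
    intro g
    change ((coind f).map (coindCounit f N)).toLinearMap
      ((coindUnit f ((coind f).obj N)).toLinearMap g) = g
    apply Subtype.ext
    ext b
    rw [coind_map_apply, coindCounit_apply, coindUnit_apply, coind_act_apply, one_mul]

/-- The unit `n ↦ (b ↦ E(b) · n)` defined by a Frobenius system. -/
noncomputable def frobeniusUnit (f : C →ₗc[K] D) (S : FrobeniusSystem (dualAlgHom f).toRingHom)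
    (N : RightComodule K D) : N ⟶ (corestrict f).obj ((coind f).obj N) :=
  homOfAct (toCoind f N (N.act.toLinearMap ∘ₗ functionalLinear f S).flip
    -- Left `D*`-linearity of `E` puts the values in the `D*`-linear maps; right `D*`-linearity,
    -- below, gives colinearity in `n`.
    (fun n a b => by
      change N.act (S.functional _) n = N.act a (N.act (S.functional b) n)
      rw [← N.act_mul_apply]
      congr 2
      exact S.map_mul_left a b))
    (fun a n => by
      rw [corestrict_act]
      apply Subtype.ext
      ext b
      rw [coind_act_apply]
      change N.act (S.functional b) (N.act a n) = N.act (S.functional _) n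
      rw [← act_mul_apply]
      congr 2
      exact (S.map_mul_right b a).symm)

theorem frobeniusUnit_apply (f : C →ₗc[K] D) (S : FrobeniusSystem (dualAlgHom f).toRingHom)
    (N : RightComodule K D) (n : N.carrier) (b : ConvDual K C) :
    ((frobeniusUnit f S N).toLinearMap n).1 b = N.act (S.functional b) n := rfl

/-- The counit `g ↦ ∑ xᵢ · g(yᵢ)` defined by a Frobenius system. -/
noncomputable def frobeniusCounit (f : C →ₗc[K] D)
    (S : FrobeniusSystem (dualAlgHom f).toRingHom) (M : RightComodule K C) :
    (coind f).obj ((corestrict f).obj M) ⟶ M :=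
  homOfAct (∑ i, M.act (S.x i) ∘ₗ LinearMap.applyₗ (S.y i) ∘ₗ
      (coindSubmodule f ((corestrict f).obj M)).subtype)
    (fun c g => by
      simp only [LinearMap.sum_apply]
      refine Eq.trans ?_ (sum_act_comm f S M g c)
      refine Finset.sum_congr rfl fun i _ => congrArg (M.act (S.x i)) ?_
      exact coind_act_apply f _ c (S.y i) g)

theorem frobeniusCounit_apply (f : C →ₗc[K] D) (S : FrobeniusSystem (dualAlgHom f).toRingHom)
    (M : RightComodule K C) (g : coindSubmodule f ((corestrict f).obj M)) :
    (frobeniusCounit f S M).toLinearMap g = ∑ i, M.act (S.x i) (g.1 (S.y i)) :=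
  LinearMap.sum_apply _ _ _

/-- The adjunction making coinduction left adjoint to corestriction, defined by a Frobenius
system for the dual algebra map. -/
noncomputable def coindCorestrictAdjunction (f : C →ₗc[K] D)
    (S : FrobeniusSystem (dualAlgHom f).toRingHom) : coind f ⊣ corestrict f where
  unit :=
    { app := frobeniusUnit f S
      naturality := fun M N h => by
        apply hom_ext
        intro m
        apply Subtype.ext
        ext b
        exact (h.map_act (S.functional b) m).symm }
  counit :=
    { app := frobeniusCounit f S
      naturality := fun M N h => by
        apply hom_ext
        intro g
        change (frobeniusCounit f S N).toLinearMap _ =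
          h.toLinearMap ((frobeniusCounit f S M).toLinearMap g)
        rw [frobeniusCounit_apply, frobeniusCounit_apply, map_sum]
        exact Finset.sum_congr rfl fun i _ => (h.map_act _ _).symm }
  left_triangle_components N := by
    apply hom_ext
    intro g
    change (frobeniusCounit f S ((coind f).obj N)).toLinearMap
      (((coind f).map (frobeniusUnit f S N)).toLinearMap g) = g
    rw [frobeniusCounit_apply]
    apply Subtype.ext
    ext b
    rw [Submodule.coe_sum, LinearMap.sum_apply]
    -- This triangle is `b = ∑ φ(E(b xᵢ)) yᵢ` inside the `D*`-linear map `g`.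
    conv_rhs => rw [← S.sum_left b, map_sum]
    refine Finset.sum_congr rfl fun i _ => ?_
    rw [coind_act_apply]
    exact (g.2 _ _).symm
  right_triangle_components M := by
    apply hom_ext
    intro m
    change (frobeniusCounit f S M).toLinearMap
      ((frobeniusUnit f S ((corestrict f).obj M)).toLinearMap m) = m
    rw [frobeniusCounit_apply]
    -- This triangle is `1 = ∑ xᵢ φ(E(yᵢ))` acting on `m`.
    conv_rhs => rw [← M.act_one_apply m, ← S.sum_right 1, map_sum, LinearMap.sum_apply]
    refine Finset.sum_congr rfl fun i _ => ?_
    rw [frobeniusUnit_apply, corestrict_act, act_mul_apply, mul_one]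
    rfl

theorem isFrobeniusCoalgebraExtension_of_frobeniusSystem (f : C →ₗc[K] D)
    (S : FrobeniusSystem (dualAlgHom f).toRingHom) : IsFrobeniusCoalgebraExtension f :=
  ⟨coind f, coind f, ⟨coindCorestrictAdjunction f S⟩, ⟨corestrictCoindAdjunction f⟩,
    ⟨Iso.refl _⟩⟩

/-- Right adjoints are unique, so the given right adjoint is coinduction, and the given left adjoint
is isomorphic to it. -/
theorem nonempty_coind_adjunction {f : C →ₗc[K] D}
    (h : IsFrobeniusCoalgebraExtension f) : Nonempty (coind f ⊣ corestrict f) := by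
  obtain ⟨L, R, ⟨adjL⟩, ⟨adjR⟩, ⟨e⟩⟩ := h
  exact ⟨adjL.ofNatIsoLeft (e ≪≫ adjR.rightAdjointUniq (corestrictCoindAdjunction f))⟩

end RightComodule

/-! ### From an adjunction back to a Frobenius system. -/

/-- A functional on `V →ₗ W` with `V` finite-dimensional is of the form `g ↦ ∑ xᵢ(g(yᵢ))`. -/
theorem LinearMap.exists_sum_dual_apply_eq {K V W : Type*} [Field K] [AddCommGroup V] [Module K V]
    [FiniteDimensional K V] [AddCommGroup W] [Module K W] (t : (V →ₗ[K] W) →ₗ[K] K) :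
    ∃ (n : ℕ) (x : Fin n → W →ₗ[K] K) (y : Fin n → V), ∀ g, t g = ∑ i, x i (g (y i)) := by
  -- `yᵢ` runs through a basis, and `xᵢ(w)` is the value of `t` on the map of rank at most one `v ↦
  -- yᵢ*(v) w`.
  refine ⟨_, fun i => t ∘ₗ LinearMap.smulRightₗ ((Module.finBasis K V).coord i),
    Module.finBasis K V, fun g => ?_⟩
  have hg : g = ∑ i, ((Module.finBasis K V).coord i).smulRight (g (Module.finBasis K V i)) := by
    apply (Module.finBasis K V).ext
    intro j
    simp [Finsupp.single_apply]
  conv_lhs => rw [hg, map_sum]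
  rfl

namespace RightComodule

variable {K C D : Type u} [Field K] [AddCommGroup C] [Module K C] [Coalgebra K C]
  [AddCommGroup D] [Module K D] [Coalgebra K D]

theorem counit_regular_act (a : ConvDual K C) (c : C) :
    Coalgebra.counit (R := K) ((regular K C).act a c) = a.ofConv c := by
  conv_rhs => rw [← one_mul a, ← dual_regular_act]
  rfl

/-- The counit recovers `a` from its action on `C`; identities in a dual algebra can therefore be
checked on the regular comodule. -/
theorem eq_of_forall_regular_act_eq {a b : ConvDual K C}
    (h : ∀ c : C, (regular K C).act a c = (regular K C).act b c) : a = b := by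
  apply WithConv.ext
  ext c
  rw [← counit_regular_act, h, counit_regular_act]

theorem eq_of_forall_counit_coeffMap_eq (M : RightComodule K C) {m n : M.carrier}
    (h : ∀ p, Coalgebra.counit (R := K) ((M.coeffMap p).toLinearMap m) =
      Coalgebra.counit (R := K) ((M.coeffMap p).toLinearMap n)) : m = n := by
  apply eq_of_forall_dual_apply_eq (K := K)
  intro p
  rw [← counit_coeffMap, h, counit_coeffMap]

variable [FiniteDimensional K C]

/-- The map `E : C* → D*` given by the unit at `D` of an adjunction between coinduction and
corestriction. -/
noncomputable def unitFunctional {f : C →ₗc[K] D} (adj : coind f ⊣ corestrict f) :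
    ConvDual K C →+ ConvDual K D where
  toFun b := WithConv.toConv (Coalgebra.counit ∘ₗ LinearMap.applyₗ b ∘ₗ
    (coindSubmodule f (regular K D)).subtype ∘ₗ (adj.unit.app (regular K D)).toLinearMap)
  map_zero' := by
    apply WithConv.ext
    ext d
    simp
  map_add' b c := by
    apply WithConv.ext
    ext d
    simp

/-- The unit at `N`, evaluated at `n`, as a `D*`-linear map `C* → N`. -/
noncomputable def unitValue {f : C →ₗc[K] D} (adj : coind f ⊣ corestrict f)
    (N : RightComodule K D) (n : N.carrier) : coindSubmodule f N :=
  (adj.unit.app N).toLinearMap n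

/-- Naturality along the coefficient maps `N → D` reduces the unit at `N` to the unit at `D`, from
which `E` is defined. -/
theorem unitValue_apply {f : C →ₗc[K] D} (adj : coind f ⊣ corestrict f)
    (N : RightComodule K D) (n : N.carrier) (b : ConvDual K C) :
    (unitValue adj N n).1 b = N.act (unitFunctional adj b) n := by
  apply eq_of_forall_counit_coeffMap_eq
  intro p
  rw [counit_coeffMap N p (N.act _ n), ← dual_coeffMap]
  have := LinearMap.congr_fun (congrArg Hom.toLinearMap (adj.unit.naturality (N.coeffMap p))) n
  exact (congrArg (fun g : coindSubmodule f (regular K D) =>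
    Coalgebra.counit (R := K) (A := D) (g.1 b)) this).symm

/-- The counit at `M`, as a map on `D*`-linear maps `C* → M`. -/
noncomputable def counitValue {f : C →ₗc[K] D} (adj : coind f ⊣ corestrict f)
    (M : RightComodule K C) :
    coindSubmodule f ((corestrict f).obj M) →ₗ[K] M.carrier :=
  (adj.counit.app M).toLinearMap

/-- The counit at `C` followed by `ε` is one functional on a subspace of `Hom_K(C*, C)`, and it
yields the `xᵢ` and `yᵢ`. Naturality along the coefficient maps `M → C` carries the formula to every
`M`. -/
theorem exists_counitValue_eq {f : C →ₗc[K] D} (adj : coind f ⊣ corestrict f) :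
    ∃ (n : ℕ) (x y : Fin n → ConvDual K C), ∀ (M : RightComodule K C)
      (g : coindSubmodule f ((corestrict f).obj M)),
      counitValue adj M g = ∑ i, M.act (x i) (g.1 (y i)) := by
  have : FiniteDimensional K (ConvDual K C) :=
    Module.Finite.equiv (WithConv.linearEquiv K (C →ₗ[K] K)).symm
  -- Extending from the `D*`-linear maps to all linear maps makes the finite-sum form available.
  obtain ⟨t, ht⟩ := LinearMap.exists_extend
    ((Coalgebra.counit (R := K) (A := C)) ∘ₗ counitValue adj (regular K C))
  obtain ⟨n, x, y, hxy⟩ := LinearMap.exists_sum_dual_apply_eq t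
  refine ⟨n, fun i => WithConv.toConv (x i), y, fun M g => ?_⟩
  apply eq_of_forall_dual_apply_eq (K := K)
  intro p
  have h1 := LinearMap.congr_fun
    (congrArg Hom.toLinearMap (adj.counit.naturality (M.coeffMap p))) g
  have h2 (h : coindSubmodule f ((corestrict f).obj (regular K C))) :
      Coalgebra.counit (R := K) (counitValue adj (regular K C) h) = ∑ i, x i (h.1 (y i)) :=
    (LinearMap.congr_fun ht h).symm.trans (hxy _)
  rw [← counit_coeffMap]
  refine (congrArg (Coalgebra.counit (R := K) (A := C)) h1).symm.trans ((h2 _).trans ?_)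
  rw [map_sum]
  exact Finset.sum_congr rfl fun i _ => M.dual_coeffMap p (WithConv.toConv (x i)) _

/-- Holds because the values of the unit are `D*`-linear maps; the right-handed rule comes from
colinearity of the unit itself. -/
theorem unitFunctional_map_mul_left {f : C →ₗc[K] D} (adj : coind f ⊣ corestrict f)
    (a : ConvDual K D) (b : ConvDual K C) :
    unitFunctional adj (dualAlgHom f a * b) = a * unitFunctional adj b := by
  apply eq_of_forall_regular_act_eq
  intro d
  rw [act_mul_apply, ← unitValue_apply, ← unitValue_apply]
  exact (unitValue adj (regular K D) d).2 a b

theorem unitFunctional_map_mul_right {f : C →ₗc[K] D} (adj : coind f ⊣ corestrict f)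
    (b : ConvDual K C) (a : ConvDual K D) :
    unitFunctional adj (b * dualAlgHom f a) = unitFunctional adj b * a := by
  apply eq_of_forall_regular_act_eq
  intro d
  rw [act_mul_apply, ← unitValue_apply, ← unitValue_apply]
  have h := (adj.unit.app (regular K D)).map_act a d
  have h' := congrArg (fun g : coindSubmodule f (regular K D) => g.1 b) h
  have h'' := congrArg (fun g : coindSubmodule f (regular K D) => g.1 b)
    (corestrict_act f ((coind f).obj (regular K D)) a (unitValue adj (regular K D) d))
  exact (coind_act_apply f (regular K D) _ b _).symm.trans (h''.symm.trans h'.symm)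

theorem counitValue_map_unit {f : C →ₗc[K] D} (adj : coind f ⊣ corestrict f)
    (N : RightComodule K D) (g : coindSubmodule f N) :
    counitValue adj ((coind f).obj N) (((coind f).map (adj.unit.app N)).toLinearMap g) = g :=
  LinearMap.congr_fun (congrArg Hom.toLinearMap (adj.left_triangle_components N)) g

theorem nonempty_frobeniusSystem_of_adjunction {f : C →ₗc[K] D}
    (adj : coind f ⊣ corestrict f) : Nonempty (FrobeniusSystem (dualAlgHom f).toRingHom) := by
  obtain ⟨n, x, y, hxy⟩ := exists_counitValue_eq adj
  refine ⟨⟨unitFunctional adj, unitFunctional_map_mul_left adj,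
    unitFunctional_map_mul_right adj, n, x, y, fun b => ?_, fun b => ?_⟩⟩
  · change ∑ i, dualAlgHom f (unitFunctional adj (b * x i)) * y i = b
    -- The left triangle at `D` gives the first dual basis identity only after applying a
    -- `D*`-linear `g : C* → D`.
    have h (g : coindSubmodule f (regular K D)) :
        g.1 (∑ i, dualAlgHom f (unitFunctional adj (b * x i)) * y i) = g.1 b := by
      have h1 := counitValue_map_unit adj (regular K D) g
      rw [hxy] at h1
      have h2 := congrArg (coindSubmodule f (regular K D)).subtype h1
      rw [map_sum] at h2
      refine Eq.trans ?_ (LinearMap.congr_fun h2 b)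
      rw [LinearMap.sum_apply, map_sum]
      refine Finset.sum_congr rfl fun i _ => ?_
      refine Eq.trans ?_ (coind_act_apply f (regular K D) (x i) b
        (unitValue adj (regular K D) (g.1 (y i)))).symm
      rw [unitValue_apply]
      exact g.2 _ _
    apply WithConv.ext
    ext c
    -- Such `g` separate `C*`: for each `c` there is one with `ε(g(b)) = b(c)`.
    have h1 (b : ConvDual K C) : b.ofConv c = Coalgebra.counit (R := K) (A := D)
        ((((coind f).map (((corestrict f).obj (regular K C)).coeffMap Coalgebra.counit)).toLinearMap
          ((coindUnit f (regular K C)).toLinearMap c)).1 b) := by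
      rw [coind_map_apply, counit_coeffMap, coindUnit_apply, counit_regular_act]
    rw [h1, h, ← h1]
  · change ∑ i, x i * dualAlgHom f (unitFunctional adj (y i * b)) = b
    apply eq_of_forall_regular_act_eq
    intro c
    -- The right triangle at `C`, acted on by `b`, gives the second identity, since the counit
    -- commutes with the action.
    have h1 : counitValue adj (regular K C)
        (unitValue adj ((corestrict f).obj (regular K C)) c) = c :=
      LinearMap.congr_fun
        (congrArg Hom.toLinearMap (adj.right_triangle_components (regular K C))) c
    have h2 := (adj.counit.app (regular K C)).map_act b
      (unitValue adj ((corestrict f).obj (regular K C)) c)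
    have h3 : counitValue adj (regular K C)
        (((coind f).obj ((corestrict f).obj (regular K C))).act b
          (unitValue adj ((corestrict f).obj (regular K C)) c)) = (regular K C).act b c :=
      h2.trans (congrArg ((regular K C).act b) h1)
    rw [← h3, hxy, map_sum, LinearMap.sum_apply]
    refine Finset.sum_congr rfl fun i _ => ?_
    rw [coind_act_apply, unitValue_apply, corestrict_act, act_mul_apply]

/-- Corestriction along `f` is a Frobenius functor if and only if the dual algebra map has a
Frobenius system. -/
theorem isFrobeniusCoalgebraExtension_iff (f : C →ₗc[K] D) :
    IsFrobeniusCoalgebraExtension f ↔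
      Nonempty (FrobeniusSystem (dualAlgHom f).toRingHom) :=
  ⟨fun h => (nonempty_coind_adjunction h).elim nonempty_frobeniusSystem_of_adjunction,
    fun ⟨S⟩ => isFrobeniusCoalgebraExtension_of_frobeniusSystem f S⟩

end RightComodule

/-! ### `C` as a direct summand of `Dⁿ`: right comodules. -/

namespace RightComodule

variable {K C D : Type u} [Field K] [AddCommGroup C] [Module K C] [Coalgebra K C]
  [AddCommGroup D] [Module K D] [Coalgebra K D]

/-- The retraction `p` need not be colinear: after slicing, it is applied only to vectors already in
`W`. -/
theorem rid_lTensor_restrict_coact (M : RightComodule K C) (W : Submodule K M.carrier)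
    (hW : ∀ b, ∀ m ∈ W, M.act b m ∈ W) (p : M.carrier →ₗ[K] W) (hp : p ∘ₗ W.subtype = LinearMap.id)
    (b : ConvDual K C) (w : W) :
    TensorProduct.rid K W (b.ofConv.lTensor W ((p.rTensor C ∘ₗ M.coact ∘ₗ W.subtype) w)) =
      ⟨M.act b w, hW b w w.2⟩ := by
  refine Eq.trans ?_ (LinearMap.congr_fun hp ⟨M.act b w, hW b w w.2⟩)
  change _ = p (M.act b w)
  rw [act_apply, LinearMap.comp_apply, LinearMap.comp_apply, Submodule.subtype_apply]
  induction M.coact w using TensorProduct.induction_on with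
  | zero => simp
  | tmul x y => simp
  | add x y hx hy => simp only [map_add, hx, hy]

/-- The subcomodule on a subspace stable under the dual algebra; the coaction is restricted with
the help of a linear retraction `p`. -/
abbrev subcomodule (M : RightComodule K C) (W : Submodule K M.carrier)
    (hW : ∀ b, ∀ m ∈ W, M.act b m ∈ W) (p : M.carrier →ₗ[K] W)
    (hp : p ∘ₗ W.subtype = LinearMap.id) : RightComodule K C where
  carrier := W
  coact := p.rTensor C ∘ₗ M.coact ∘ₗ W.subtype
  coassoc := coassoc_of_convMul _ fun a b w => by
    simp only [M.rid_lTensor_restrict_coact W hW p hp, act_mul_apply]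
  counit_coact := by
    ext w
    exact (congrArg Subtype.val (M.rid_lTensor_restrict_coact W hW p hp 1 w)).trans
      (M.act_one_apply w)

/-- The kernel is stable under the dual algebra, hence a subcomodule, and `g` does not distinguish
its inclusion from zero. Needed because injective objects are defined by monomorphisms. -/
theorem injective_of_mono {M N : RightComodule K C} (g : M ⟶ N) [Mono g] :
    Function.Injective g.toLinearMap := by
  have hW (b) (m) (hm : m ∈ LinearMap.ker g.toLinearMap) :
      M.act b m ∈ LinearMap.ker g.toLinearMap := by
    rw [LinearMap.mem_ker] at hm ⊢
    rw [g.map_act, hm, map_zero]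
  obtain ⟨p, hp⟩ := LinearMap.exists_leftInverse_of_injective _
    (LinearMap.ker g.toLinearMap).ker_subtype
  let i : M.subcomodule (LinearMap.ker g.toLinearMap) hW p hp ⟶ M :=
    homOfAct (Submodule.subtype _)
      fun b m => congrArg Subtype.val (M.rid_lTensor_restrict_coact _ hW p hp b m)
  let z : M.subcomodule (LinearMap.ker g.toLinearMap) hW p hp ⟶ M := homOfAct 0 (by simp)
  have h : i = z := by
    rw [← cancel_mono g]
    apply hom_ext
    intro m
    exact (LinearMap.mem_ker.mp m.2).trans (map_zero g.toLinearMap).symm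
  rw [← LinearMap.ker_eq_bot, eq_bot_iff]
  intro m hm
  exact LinearMap.congr_fun (congrArg Hom.toLinearMap h) ⟨m, hm⟩

/-- Colinear maps into `C` are determined by their composite with `ε`, so it suffices to extend a
functional linearly. -/
theorem exists_extension_to_regular {M N : RightComodule K C} (j : M ⟶ N)
    (hj : Function.Injective j.toLinearMap) (h : M ⟶ regular K C) :
    ∃ k : N ⟶ regular K C, ∀ m, k.toLinearMap (j.toLinearMap m) = h.toLinearMap m := by
  obtain ⟨s, hs⟩ := LinearMap.exists_leftInverse_of_injective j.toLinearMap
    (LinearMap.ker_eq_bot.mpr hj)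
  refine ⟨N.coeffMap (Coalgebra.counit ∘ₗ h.toLinearMap ∘ₗ s), fun m => ?_⟩
  apply eq_of_forall_dual_apply_eq (K := K)
  intro b
  have hs' (m) : s (j.toLinearMap m) = m := LinearMap.congr_fun hs m
  refine (dual_coeffMap N _ (WithConv.toConv b) _).trans ?_
  rw [← j.map_act, LinearMap.comp_apply, LinearMap.comp_apply, hs', h.map_act]
  exact counit_regular_act _ _

/-- The sum of a finite family of colinear maps. -/
def homSum {ι : Type*} (s : Finset ι) {M N : RightComodule K C} (g : ι → (M ⟶ N)) : M ⟶ N :=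
  homOfAct (∑ i ∈ s, (g i).toLinearMap) (fun b m => by
    simp only [LinearMap.sum_apply, map_sum, Hom.map_act])

/-- The hypothesis exhibits `M` as a direct summand of `Cⁿ`; each component of a map into `Cⁿ`
extends separately. -/
theorem injective_of_retract {M : RightComodule K C} {n : ℕ} (i : Fin n → (M ⟶ regular K C))
    (p : Fin n → (regular K C ⟶ M))
    (h : ∀ m, ∑ k, (p k).toLinearMap ((i k).toLinearMap m) = m) : Injective M where
  factors {X Y} g j _ := by
    choose e he using fun k => exists_extension_to_regular j (injective_of_mono j) (g ≫ i k)
    refine ⟨homSum Finset.univ fun k => e k ≫ p k, ?_⟩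
    apply hom_ext
    intro x
    rw [← h (g.toLinearMap x)]
    change (∑ k, (e k ≫ p k).toLinearMap) (j.toLinearMap x) = _
    rw [LinearMap.sum_apply]
    exact Finset.sum_congr rfl fun k _ => congrArg (p k).toLinearMap (he k x)

theorem isFinitelyCogenerated_of_retract {M : RightComodule K C} {n : ℕ}
    (i : Fin n → (M ⟶ regular K C)) (p : Fin n → (regular K C ⟶ M))
    (h : ∀ m, ∑ k, (p k).toLinearMap ((i k).toLinearMap m) = m) :
    M.IsFinitelyCogenerated := by
  refine ⟨n, ⟨LinearMap.pi fun k => (i k).toLinearMap, ?_⟩, fun m m' hm => ?_⟩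
  · have hpi : (LinearMap.pi fun k => (i k).toLinearMap) =
        ∑ k, LinearMap.single K (fun _ : Fin n => C) k ∘ₗ (i k).toLinearMap := by
      ext m k
      simp [LinearMap.sum_apply, Finset.sum_apply, Pi.single_apply]
    have hsum : (LinearMap.pi fun k => (i k).toLinearMap).rTensor C =
        ∑ k, (LinearMap.single K (fun _ : Fin n => C) k).rTensor C ∘ₗ
          (i k).toLinearMap.rTensor C := by
      rw [hpi, ← LinearMap.coe_rTensorHom, map_sum]
      simp only [LinearMap.coe_rTensorHom, LinearMap.rTensor_comp]
    rw [hsum]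
    ext1 m
    simp only [LinearMap.comp_apply, LinearMap.sum_apply, LinearMap.proj_apply, LinearMap.pi_apply]
    exact Finset.sum_congr rfl fun k _ =>
      congrArg _ (LinearMap.congr_fun (i k).comm m)
  · rw [← h m, ← h m']
    exact Finset.sum_congr rfl fun k _ => congrArg (p k).toLinearMap (congrFun hm k)

theorem dual_corestrict_regular_act (f : C →ₗc[K] D) (a : ConvDual K D) (b : ConvDual K C)
    (c : C) : b.ofConv (((corestrict f).obj (regular K C)).act a c) =
      (b * dualAlgHom f a).ofConv c :=
  (congrArg b.ofConv (corestrict_act f (regular K C) a c)).trans (dual_regular_act _ _ _)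

variable [FiniteDimensional K C]

/-- The map `D → C` whose transpose is the functional `C* → D*` of a Frobenius system. -/
noncomputable def _root_.FrobeniusSystem.cofunctional {f : C →ₗc[K] D}
    (S : FrobeniusSystem (dualAlgHom f).toRingHom) : D →ₗ[K] C :=
  -- Flipping `E` gives `D → C**`, and `C** ≅ C` in finite dimension; `D` may be
  -- infinite-dimensional.
  (Module.evalEquiv K C).symm.toLinearMap ∘ₗ
    LinearMap.flip ((WithConv.linearEquiv K (D →ₗ[K] K)).toLinearMap ∘ₗ functionalLinear f S ∘ₗ
      (WithConv.linearEquiv K (C →ₗ[K] K)).symm.toLinearMap)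

theorem _root_.FrobeniusSystem.dual_cofunctional {f : C →ₗc[K] D}
    (S : FrobeniusSystem (dualAlgHom f).toRingHom) (b : ConvDual K C) (d : D) :
    b.ofConv (S.cofunctional d) = (S.functional b).ofConv d :=
  Module.apply_evalEquiv_symm_apply K C b.ofConv _

/-- The `i`-th colinear map `c ↦ xᵢ(c₁) f(c₂)` from `C` to `D`. -/
noncomputable def coordinateMap {f : C →ₗc[K] D} (S : FrobeniusSystem (dualAlgHom f).toRingHom)
    (i : Fin S.size) : (corestrict f).obj (regular K C) ⟶ regular K D :=
  coeffMap _ (S.x i).ofConv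

/-- The linear map `d ↦ y(θ(d)₁) θ(d)₂` from `D` to `C`, with `θ` dual to the functional of a
Frobenius system. -/
noncomputable def generatorLinear {f : C →ₗc[K] D} (S : FrobeniusSystem (dualAlgHom f).toRingHom)
    (y : ConvDual K C) : D →ₗ[K] C :=
  ((regular K C).coeffMap y.ofConv).toLinearMap ∘ₗ S.cofunctional

/-- The transpose of this map is `b ↦ E(y b)`, so its colinearity reduces to right `D*`-linearity of
`E`. -/
theorem dual_generatorLinear {f : C →ₗc[K] D} (S : FrobeniusSystem (dualAlgHom f).toRingHom)
    (y b : ConvDual K C) (d : D) :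
    b.ofConv (generatorLinear S y d) = (S.functional (y * b)).ofConv d := by
  refine (dual_coeffMap (regular K C) _ b _).trans ?_
  rw [dual_regular_act, S.dual_cofunctional]

theorem generatorLinear_act {f : C →ₗc[K] D} (S : FrobeniusSystem (dualAlgHom f).toRingHom)
    (y : ConvDual K C) (a : ConvDual K D) (d : D) :
    generatorLinear S y ((regular K D).act a d) =
      ((corestrict f).obj (regular K C)).act a (generatorLinear S y d) := by
  apply eq_of_forall_dual_apply_eq (K := K)
  intro b
  have h1 := dual_generatorLinear S y (WithConv.toConv b) ((regular K D).act a d)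
  have h2 := dual_generatorLinear S y (WithConv.toConv b * dualAlgHom f a) d
  have h3 := dual_corestrict_regular_act f a (WithConv.toConv b) (generatorLinear S y d)
  refine h1.trans (Eq.trans ?_ (h3.trans h2).symm)
  rw [dual_regular_act, ← mul_assoc]
  exact congrArg (fun e : ConvDual K D => e.ofConv d) (S.map_mul_right _ a).symm

/-- The `i`-th colinear map `d ↦ yᵢ(θ(d)₁) θ(d)₂` from `D` to `C`. -/
noncomputable def generatorMap {f : C →ₗc[K] D} (S : FrobeniusSystem (dualAlgHom f).toRingHom)
    (i : Fin S.size) : regular K D ⟶ (corestrict f).obj (regular K C) :=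
  homOfAct (generatorLinear S (S.y i)) (generatorLinear_act S (S.y i))

/-- The transpose of the identity `b = ∑ xᵢ φ(E(yᵢ b))`. -/
theorem sum_generatorMap_coordinateMap {f : C →ₗc[K] D}
    (S : FrobeniusSystem (dualAlgHom f).toRingHom) (c : C) :
    ∑ i, (generatorMap S i).toLinearMap ((coordinateMap S i).toLinearMap c) = c := by
  apply eq_of_forall_dual_apply_eq (K := K)
  intro b
  rw [map_sum]
  conv_rhs => rw [← WithConv.ofConv_toConv b, ← S.sum_right (WithConv.toConv b),
    WithConv.ofConv_sum, LinearMap.sum_apply]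
  refine Finset.sum_congr rfl fun i _ => ?_
  refine (dual_generatorLinear S (S.y i) (WithConv.toConv b) _).trans ?_
  refine (dual_coeffMap ((corestrict f).obj (regular K C)) _ _ _).trans ?_
  exact dual_corestrict_regular_act f _ (S.x i) c

end RightComodule

/-! ### `C` as a direct summand of `Dⁿ`: left comodules, as right modules over the dual algebra. -/

namespace LeftComodule

variable {K C D : Type u} [Field K] [AddCommGroup C] [Module K C] [Coalgebra K C]
  [AddCommGroup D] [Module K D] [Coalgebra K D]

theorem hom_ext {M N : LeftComodule K C} {f g : M ⟶ N}
    (h : ∀ m, f.toLinearMap m = g.toLinearMap m) : f = g :=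
  Hom.ext (LinearMap.ext h)

/-- The right action `m · b = b(m₋₁) m₀` of the dual algebra on a left comodule. -/
noncomputable def act (M : LeftComodule K C) (b : ConvDual K C) : M.carrier →ₗ[K] M.carrier :=
  (TensorProduct.lid K M.carrier).toLinearMap ∘ₗ b.ofConv.rTensor M.carrier ∘ₗ M.coact

theorem act_apply (M : LeftComodule K C) (b : ConvDual K C) (m : M.carrier) :
    M.act b m = TensorProduct.lid K M.carrier (b.ofConv.rTensor M.carrier (M.coact m)) := rfl

theorem act_one_apply (M : LeftComodule K C) (m : M.carrier) : M.act 1 m = m :=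
  LinearMap.congr_fun M.counit_coact m

theorem lid_rTensor_comul {V : Type*} [AddCommGroup V] [Module K V]
    (a b : ConvDual K C) (t : C ⊗[K] V) :
    TensorProduct.lid K V (b.ofConv.rTensor V (TensorProduct.lid K _
      (a.ofConv.rTensor (C ⊗[K] V) (TensorProduct.assoc K C C V
        ((Coalgebra.comul (R := K) (A := C)).rTensor V t))))) =
      TensorProduct.lid K V ((a * b).ofConv.rTensor V t) := by
  induction t using TensorProduct.induction_on with
  | zero => simp
  | tmul x y =>
    simp only [LinearMap.rTensor_tmul, LinearMap.convMul_apply]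
    induction Coalgebra.comul (R := K) x using TensorProduct.induction_on with
    | zero => simp
    | tmul c d => simp [smul_smul]
    | add c d hc hd => simp only [map_add, TensorProduct.add_tmul, hc, hd]
  | add x y hx hy => simp only [map_add, hx, hy]

theorem act_mul_apply (M : LeftComodule K C) (a b : ConvDual K C) (m : M.carrier) :
    M.act (a * b) m = M.act b (M.act a m) := by
  have h := LinearMap.congr_fun M.coassoc m
  simp only [LinearMap.comp_apply, LinearEquiv.coe_coe] at h
  rw [act_apply, ← lid_rTensor_comul, h, TensorProduct.lid_rTensor_lTensor]
  rfl

/-- A linear map `V → C ⊗ V` is coassociative if it defines a right action of the dual algebra. -/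
theorem coassoc_of_convMul {V : Type*} [AddCommGroup V] [Module K V] (r : V →ₗ[K] C ⊗[K] V)
    (h : ∀ (a b : ConvDual K C) v, TensorProduct.lid K V ((a * b).ofConv.rTensor V (r v)) =
      TensorProduct.lid K V (b.ofConv.rTensor V
        (r (TensorProduct.lid K V (a.ofConv.rTensor V (r v)))))) :
    (TensorProduct.assoc K C C V).toLinearMap ∘ₗ
      (Coalgebra.comul (R := K) (A := C)).rTensor V ∘ₗ r = r.lTensor C ∘ₗ r := by
  ext v
  apply TensorProduct.eq_of_forall_rTensor_dual_eq
  intro a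
  apply (TensorProduct.lid K _).injective
  apply TensorProduct.eq_of_forall_rTensor_dual_eq
  intro b
  apply (TensorProduct.lid K _).injective
  exact (lid_rTensor_comul (WithConv.toConv a) (WithConv.toConv b) _).trans
    ((h _ _ v).trans (TensorProduct.lid_rTensor_lTensor r a b _).symm)

theorem Hom.map_act {M N : LeftComodule K C} (g : M ⟶ N) (b : ConvDual K C) (m : M.carrier) :
    g.toLinearMap (M.act b m) = N.act b (g.toLinearMap m) := by
  have := LinearMap.congr_fun g.comm m
  simp only [LinearMap.comp_apply] at this
  rw [act_apply, act_apply, this]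
  induction M.coact m using TensorProduct.induction_on with
  | zero => simp
  | tmul x y => simp
  | add x y hx hy => simp only [map_add, hx, hy]

/-- Over a field, linear maps commuting with the actions of the dual algebra are colinear. -/
def homOfAct {M N : LeftComodule K C} (g : M.carrier →ₗ[K] N.carrier)
    (h : ∀ b m, g (M.act b m) = N.act b (g m)) : M ⟶ N where
  toLinearMap := g
  comm := by
    ext m
    apply TensorProduct.eq_of_forall_rTensor_dual_eq
    intro b
    apply (TensorProduct.lid K N.carrier).injective
    have := h (WithConv.toConv b) m
    rw [act_apply, act_apply] at this
    rw [LinearMap.comp_apply, ← WithConv.ofConv_toConv b, ← this, LinearMap.comp_apply]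
    generalize M.coact m = t
    induction t using TensorProduct.induction_on with
    | zero => simp
    | tmul x y => simp
    | add x y hx hy => simp only [map_add, hx, hy]

/-- Here the action is the transpose of left multiplication, which interchanges `xᵢ` and `yᵢ` in
what follows. -/
theorem dual_regular_act (a b : ConvDual K C) (c : C) :
    b.ofConv ((regular K C).act a c) = (a * b).ofConv c := by
  rw [act_apply, LinearMap.convMul_apply]
  change b.ofConv (TensorProduct.lid K C (a.ofConv.rTensor C (Coalgebra.comul c))) = _
  induction Coalgebra.comul (R := K) c using TensorProduct.induction_on with
  | zero => simp
  | tmul x y => simp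
  | add x y hx hy => simp only [map_add, hx, hy]

theorem counit_regular_act (a : ConvDual K C) (c : C) :
    Coalgebra.counit (R := K) ((regular K C).act a c) = a.ofConv c := by
  conv_rhs => rw [← mul_one a, ← dual_regular_act]
  rfl

theorem corestrict_act (f : C →ₗc[K] D) (M : LeftComodule K C) (a : ConvDual K D)
    (m : M.carrier) : ((corestrict f).obj M).act a m = M.act (dualAlgHom f a) m := by
  rw [act_apply, act_apply]
  change TensorProduct.lid K M.carrier (a.ofConv.rTensor M.carrier
    (f.toLinearMap.rTensor M.carrier (M.coact m))) = _
  rw [← LinearMap.rTensor_comp_apply]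
  rfl

theorem dual_rid_lTensor_coact (M : LeftComodule K C) (p : M.carrier →ₗ[K] K) (b : ConvDual K C)
    (m : M.carrier) : b.ofConv (TensorProduct.rid K C (p.lTensor C (M.coact m))) =
      p (M.act b m) := by
  rw [act_apply]
  induction M.coact m using TensorProduct.induction_on with
  | zero => simp
  | tmul x y => simp [mul_comm]
  | add x y hx hy => simp only [map_add, hx, hy]

/-- The colinear map `m ↦ m₋₁ p(m₀)` defined by a functional `p`. -/
def coeffMap (M : LeftComodule K C) (p : M.carrier →ₗ[K] K) : M ⟶ regular K C :=
  homOfAct ((TensorProduct.rid K C).toLinearMap ∘ₗ p.lTensor C ∘ₗ M.coact) (by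
    intro a m
    apply eq_of_forall_dual_apply_eq (K := K)
    intro b
    exact (dual_rid_lTensor_coact M p (WithConv.toConv b) _).trans (by
      rw [← act_mul_apply, ← dual_rid_lTensor_coact, ← dual_regular_act]; rfl))

theorem dual_coeffMap (M : LeftComodule K C) (p : M.carrier →ₗ[K] K) (b : ConvDual K C)
    (m : M.carrier) : b.ofConv ((M.coeffMap p).toLinearMap m) = p (M.act b m) :=
  dual_rid_lTensor_coact M p b m

theorem lid_rTensor_restrict_coact (M : LeftComodule K C) (W : Submodule K M.carrier)
    (hW : ∀ b, ∀ m ∈ W, M.act b m ∈ W) (p : M.carrier →ₗ[K] W) (hp : p ∘ₗ W.subtype = LinearMap.id)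
    (b : ConvDual K C) (w : W) :
    TensorProduct.lid K W (b.ofConv.rTensor W ((p.lTensor C ∘ₗ M.coact ∘ₗ W.subtype) w)) =
      ⟨M.act b w, hW b w w.2⟩ := by
  refine Eq.trans ?_ (LinearMap.congr_fun hp ⟨M.act b w, hW b w w.2⟩)
  change _ = p (M.act b w)
  rw [act_apply, LinearMap.comp_apply, LinearMap.comp_apply, Submodule.subtype_apply]
  induction M.coact w using TensorProduct.induction_on with
  | zero => simp
  | tmul x y => simp
  | add x y hx hy => simp only [map_add, hx, hy]

/-- The subcomodule on a subspace stable under the dual algebra; the coaction is restricted with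
the help of a linear retraction `p`. -/
abbrev subcomodule (M : LeftComodule K C) (W : Submodule K M.carrier)
    (hW : ∀ b, ∀ m ∈ W, M.act b m ∈ W) (p : M.carrier →ₗ[K] W)
    (hp : p ∘ₗ W.subtype = LinearMap.id) : LeftComodule K C where
  carrier := W
  coact := p.lTensor C ∘ₗ M.coact ∘ₗ W.subtype
  coassoc := coassoc_of_convMul _ fun a b w => by
    simp only [M.lid_rTensor_restrict_coact W hW p hp, act_mul_apply]
  counit_coact := by
    ext w
    exact (congrArg Subtype.val (M.lid_rTensor_restrict_coact W hW p hp 1 w)).trans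
      (M.act_one_apply w)

theorem injective_of_mono {M N : LeftComodule K C} (g : M ⟶ N) [Mono g] :
    Function.Injective g.toLinearMap := by
  have hW (b) (m) (hm : m ∈ LinearMap.ker g.toLinearMap) :
      M.act b m ∈ LinearMap.ker g.toLinearMap := by
    rw [LinearMap.mem_ker] at hm ⊢
    rw [g.map_act, hm, map_zero]
  obtain ⟨p, hp⟩ := LinearMap.exists_leftInverse_of_injective _
    (LinearMap.ker g.toLinearMap).ker_subtype
  let i : M.subcomodule (LinearMap.ker g.toLinearMap) hW p hp ⟶ M :=
    homOfAct (Submodule.subtype _)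
      fun b m => congrArg Subtype.val (M.lid_rTensor_restrict_coact _ hW p hp b m)
  let z : M.subcomodule (LinearMap.ker g.toLinearMap) hW p hp ⟶ M := homOfAct 0 (by simp)
  have h : i = z := by
    rw [← cancel_mono g]
    apply hom_ext
    intro m
    exact (LinearMap.mem_ker.mp m.2).trans (map_zero g.toLinearMap).symm
  rw [← LinearMap.ker_eq_bot, eq_bot_iff]
  intro m hm
  exact LinearMap.congr_fun (congrArg Hom.toLinearMap h) ⟨m, hm⟩

theorem exists_extension_to_regular {M N : LeftComodule K C} (j : M ⟶ N)
    (hj : Function.Injective j.toLinearMap) (h : M ⟶ regular K C) :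
    ∃ k : N ⟶ regular K C, ∀ m, k.toLinearMap (j.toLinearMap m) = h.toLinearMap m := by
  obtain ⟨s, hs⟩ := LinearMap.exists_leftInverse_of_injective j.toLinearMap
    (LinearMap.ker_eq_bot.mpr hj)
  refine ⟨N.coeffMap (Coalgebra.counit ∘ₗ h.toLinearMap ∘ₗ s), fun m => ?_⟩
  apply eq_of_forall_dual_apply_eq (K := K)
  intro b
  have hs' (m) : s (j.toLinearMap m) = m := LinearMap.congr_fun hs m
  refine (dual_coeffMap N _ (WithConv.toConv b) _).trans ?_
  rw [← j.map_act, LinearMap.comp_apply, LinearMap.comp_apply, hs', h.map_act]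
  exact counit_regular_act _ _

/-- The sum of a finite family of colinear maps. -/
def homSum {ι : Type*} (s : Finset ι) {M N : LeftComodule K C} (g : ι → (M ⟶ N)) : M ⟶ N :=
  homOfAct (∑ i ∈ s, (g i).toLinearMap) (fun b m => by
    simp only [LinearMap.sum_apply, map_sum, Hom.map_act])

theorem injective_of_retract {M : LeftComodule K C} {n : ℕ} (i : Fin n → (M ⟶ regular K C))
    (p : Fin n → (regular K C ⟶ M))
    (h : ∀ m, ∑ k, (p k).toLinearMap ((i k).toLinearMap m) = m) : Injective M where
  factors {X Y} g j _ := by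
    choose e he using fun k => exists_extension_to_regular j (injective_of_mono j) (g ≫ i k)
    refine ⟨homSum Finset.univ fun k => e k ≫ p k, ?_⟩
    apply hom_ext
    intro x
    rw [← h (g.toLinearMap x)]
    change (∑ k, (e k ≫ p k).toLinearMap) (j.toLinearMap x) = _
    rw [LinearMap.sum_apply]
    exact Finset.sum_congr rfl fun k _ => congrArg (p k).toLinearMap (he k x)

theorem isFinitelyCogenerated_of_retract {M : LeftComodule K C} {n : ℕ}
    (i : Fin n → (M ⟶ regular K C)) (p : Fin n → (regular K C ⟶ M))
    (h : ∀ m, ∑ k, (p k).toLinearMap ((i k).toLinearMap m) = m) :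
    M.IsFinitelyCogenerated := by
  refine ⟨n, ⟨LinearMap.pi fun k => (i k).toLinearMap, ?_⟩, fun m m' hm => ?_⟩
  · have hpi : (LinearMap.pi fun k => (i k).toLinearMap) =
        ∑ k, LinearMap.single K (fun _ : Fin n => C) k ∘ₗ (i k).toLinearMap := by
      ext m k
      simp [LinearMap.sum_apply, Finset.sum_apply, Pi.single_apply]
    have hsum : (LinearMap.pi fun k => (i k).toLinearMap).lTensor C =
        ∑ k, (LinearMap.single K (fun _ : Fin n => C) k).lTensor C ∘ₗ
          (i k).toLinearMap.lTensor C := by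
      rw [hpi, ← LinearMap.coe_lTensorHom, map_sum]
      simp only [LinearMap.coe_lTensorHom, LinearMap.lTensor_comp]
    rw [hsum]
    ext1 m
    simp only [LinearMap.comp_apply, LinearMap.sum_apply, LinearMap.proj_apply, LinearMap.pi_apply]
    exact Finset.sum_congr rfl fun k _ =>
      congrArg _ (LinearMap.congr_fun (i k).comm m)
  · rw [← h m, ← h m']
    exact Finset.sum_congr rfl fun k _ => congrArg (p k).toLinearMap (congrFun hm k)

theorem dual_corestrict_regular_act (f : C →ₗc[K] D) (a : ConvDual K D) (b : ConvDual K C)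
    (c : C) : b.ofConv (((corestrict f).obj (regular K C)).act a c) =
      (dualAlgHom f a * b).ofConv c :=
  (congrArg b.ofConv (corestrict_act f (regular K C) a c)).trans (dual_regular_act _ _ _)

variable [FiniteDimensional K C]

/-- The `i`-th colinear map `c ↦ f(c₁) yᵢ(c₂)` from `C` to `D`. -/
noncomputable def coordinateMap {f : C →ₗc[K] D} (S : FrobeniusSystem (dualAlgHom f).toRingHom)
    (i : Fin S.size) : (corestrict f).obj (regular K C) ⟶ regular K D :=
  coeffMap _ (S.y i).ofConv

/-- The linear map `d ↦ θ(d)₁ x(θ(d)₂)` from `D` to `C`, with `θ` dual to the functional of a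
Frobenius system. -/
noncomputable def generatorLinear {f : C →ₗc[K] D} (S : FrobeniusSystem (dualAlgHom f).toRingHom)
    (x : ConvDual K C) : D →ₗ[K] C :=
  ((regular K C).coeffMap x.ofConv).toLinearMap ∘ₗ S.cofunctional

/-- The transpose is now `b ↦ E(b x)`, and colinearity reduces to left `D*`-linearity of `E`. -/
theorem dual_generatorLinear {f : C →ₗc[K] D} (S : FrobeniusSystem (dualAlgHom f).toRingHom)
    (x b : ConvDual K C) (d : D) :
    b.ofConv (generatorLinear S x d) = (S.functional (b * x)).ofConv d := by
  refine (dual_coeffMap (regular K C) _ b _).trans ?_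
  rw [dual_regular_act, S.dual_cofunctional]

theorem generatorLinear_act {f : C →ₗc[K] D} (S : FrobeniusSystem (dualAlgHom f).toRingHom)
    (x : ConvDual K C) (a : ConvDual K D) (d : D) :
    generatorLinear S x ((regular K D).act a d) =
      ((corestrict f).obj (regular K C)).act a (generatorLinear S x d) := by
  apply eq_of_forall_dual_apply_eq (K := K)
  intro b
  have h1 := dual_generatorLinear S x (WithConv.toConv b) ((regular K D).act a d)
  have h2 := dual_generatorLinear S x (dualAlgHom f a * WithConv.toConv b) d
  have h3 := dual_corestrict_regular_act f a (WithConv.toConv b) (generatorLinear S x d)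
  refine h1.trans (Eq.trans ?_ (h3.trans h2).symm)
  rw [dual_regular_act, mul_assoc]
  exact congrArg (fun e : ConvDual K D => e.ofConv d) (S.map_mul_left a _).symm

/-- The `i`-th colinear map `d ↦ θ(d)₁ xᵢ(θ(d)₂)` from `D` to `C`. -/
noncomputable def generatorMap {f : C →ₗc[K] D} (S : FrobeniusSystem (dualAlgHom f).toRingHom)
    (i : Fin S.size) : regular K D ⟶ (corestrict f).obj (regular K C) :=
  homOfAct (generatorLinear S (S.x i)) (generatorLinear_act S (S.x i))

/-- The transpose of the other identity, `b = ∑ φ(E(b xᵢ)) yᵢ`. -/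
theorem sum_generatorMap_coordinateMap {f : C →ₗc[K] D}
    (S : FrobeniusSystem (dualAlgHom f).toRingHom) (c : C) :
    ∑ i, (generatorMap S i).toLinearMap ((coordinateMap S i).toLinearMap c) = c := by
  apply eq_of_forall_dual_apply_eq (K := K)
  intro b
  rw [map_sum]
  conv_rhs => rw [← WithConv.ofConv_toConv b, ← S.sum_left (WithConv.toConv b),
    WithConv.ofConv_sum, LinearMap.sum_apply]
  refine Finset.sum_congr rfl fun i _ => ?_
  refine (dual_generatorLinear S (S.x i) (WithConv.toConv b) _).trans ?_
  refine (dual_coeffMap ((corestrict f).obj (regular K C)) _ _ _).trans ?_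
  exact dual_corestrict_regular_act f _ (S.y i) c

end LeftComodule

theorem proposition3p8 {K C D : Type u} [Field K]
    [AddCommGroup C] [Module K C] [Coalgebra K C] [FiniteDimensional K C]
    [AddCommGroup D] [Module K D] [Coalgebra K D] (f : C →ₗc[K] D) :
    (IsFrobeniusCoalgebraExtension f ↔ IsFrobeniusRingExtension (dualAlgHom f).toRingHom) ∧
    (IsFrobeniusCoalgebraExtension f →
      (((LeftComodule.corestrict f).obj (LeftComodule.regular K C)).IsFinitelyCogenerated ∧
        CategoryTheory.Injective ((LeftComodule.corestrict f).obj (LeftComodule.regular K C))) ∧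
      (((RightComodule.corestrict f).obj (RightComodule.regular K C)).IsFinitelyCogenerated ∧
        CategoryTheory.Injective ((RightComodule.corestrict f).obj (RightComodule.regular K C))) ∧
      IsLeftFGProjective (dualAlgHom f).toRingHom ∧
      IsRightFGProjective (dualAlgHom f).toRingHom) := by
  -- Both conditions become the existence of a Frobenius system for the dual algebra map.
  rw [isFrobeniusRingExtension_iff, RightComodule.isFrobeniusCoalgebraExtension_iff]
  refine ⟨Iff.rfl, fun ⟨S⟩ => ⟨⟨?_, ?_⟩, ⟨?_, ?_⟩, S.isLeftFGProjective, S.isRightFGProjective⟩⟩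
  · exact LeftComodule.isFinitelyCogenerated_of_retract (LeftComodule.coordinateMap S)
      (LeftComodule.generatorMap S) (LeftComodule.sum_generatorMap_coordinateMap S)
  · exact LeftComodule.injective_of_retract (LeftComodule.coordinateMap S)
      (LeftComodule.generatorMap S) (LeftComodule.sum_generatorMap_coordinateMap S)
  · exact RightComodule.isFinitelyCogenerated_of_retract (RightComodule.coordinateMap S)
      (RightComodule.generatorMap S) (RightComodule.sum_generatorMap_coordinateMap S)
  · exact RightComodule.injective_of_retract (RightComodule.coordinateMap S)
      (RightComodule.generatorMap S) (RightComodule.sum_generatorMap_coordinateMap S)
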